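/- Let $q \ge 2$ be an integer, let $\mathbb{T}_{q+1}$ be the $(q+1)$-regular tree with graph metric $d$ and a root $o$, put $B_r = \{x : d(x,o) \le r\}$ for integers $r \ge 0$, and let $G_q = \mathrm{Aut}(\mathbb{T}_{q+1})$ with the topology of pointwise convergence. *Random lattice orbits.* Let $\mathfrak{X}$ be a finite simple connected $(q+1)$-regular graph with base vertex $u$. Its fundamental group $\pi_1(\mathfrak{X},u)$ (closed paths at $u$ modulo insertion and deletion of backtrackings) acts by left concatenation on the universal covering tree (paths starting at $u$, modulo the same equivalence). Identifying this tree, rooted at the constant path, with $(\mathbb{T}_{q+1},o)$ by a rooted graph isomorphism gives a lattice $\Gamma_{\mathfrak{X}} < G_q$. Let $\mu_{\mathfrak{X}}$ be the law of the random point set $\mathcal{P}_{\mathfrak{X}} = g^{-1}\Gamma_{\mathfrak{X}}.o$ (viewed as a counting measure), where $\Gamma_{\mathfrak{X}} g$ is distributed according to the $G_q$-invariant probability measure on $\Gamma_{\mathfrak{X}} \backslash G_q$. *Diffraction.* Put $\tau = 2\pi/\log q$ and $\Lambda_q = i[0,\tfrac12] \cup (0,\tfrac{\tau}{2}) \cup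 (\tfrac{\tau}{2} + i[0,\tfrac12]) \subset \mathbb{C}$. For $\lambda \in \mathbb{C} \setminus \tfrac{\tau}{2}\mathbb{Z}$ let $$\omega_\lambda(n) = c_q(\lambda) q^{-(1/2 - i\lambda)n} + c_q(-\lambda) q^{-(1/2 + i\lambda)n}, \qquad c_q(\lambda) = \frac{1}{q^{1/2}+q^{-1/2}}\, \frac{q^{1/2+i\lambda} - q^{-1/2-i\lambda}}{q^{i\lambda} - q^{-i\lambda}},$$ and for $\lambda = \tfrac{\tau}{2} j$, $j \in \mathbb{Z}$, let $\omega_\lambda(n) = \bigl(1 + \tfrac{q^{1/2}-q^{-1/2}}{q^{1/2}+q^{-1/2}}\, n\bigr)(-1)^{jn} q^{-n/2}$. For finitely supported $f : \mathbb{T}_{q+1} \to \mathbb{C}$ that are radial ($f(x)$ depends only on $d(x,o)$), put $\hat f(\lambda) = \sum_x f(x)\, \omega_\lambda(d(x,o))$ and $\mathbb{S}f(p) = \sum_x p(\{x\}) f(x)$ for locally finite measures $p$ on $\mathbb{T}_{q+1}$. A diffraction measure of $\mu_{\mathfrak{X}}$ is a finite positive Borel measure $\sigma$ on $\Lambda_q$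 such that $$\int \mathbb{S}f_1\, \overline{\mathbb{S}f_2}\, d\mu_{\mathfrak{X}} = \int_{\Lambda_q} \hat f_1\, \overline{\hat f_2}\, d\sigma$$ for all such $f_1, f_2$. If there is exactly one, denoted $\sigma_{\mathfrak{X}}$, the sub-oscillatory number variance is $$\mathrm{NV}^*_{\mathfrak{X}}(r) = \int_{\Lambda_q \setminus \{\frac{i}{2},\, \frac{\tau+i}{2}\}} |\hat\chi_{B_r}(\lambda)|^2\, d\sigma_{\mathfrak{X}}(\lambda).$$ **Theorem.** In each of the cases (1)–(3) the diffraction measure $\sigma_{\mathfrak{X}}$ exists and is unique, and the following holds. 1. For the complete graph $\mathfrak{X} = \mathfrak{K}_{q+2}$ on $q+2$ vertices, $$\liminf_{r\to\infty} \frac{\mathrm{NV}^*_{\mathfrak{X}}(r)}{|B_r|} = 0.$$ Moreover, for $q = 2$ (the tetrahedron $\mathfrak{K}_4$), also $$\liminf_{r\to\infty} \frac{\mathrm{Var}(|\mathcal{P}_{\mathfrak{K}_4} \cap B_r|)}{|B_r|} = 0.$$ 2. For the complete bipartite graph $\mathfrak{X} = \mathfrak{K}_{q+1,q+1}$ on $(q+1)+(q+1)$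 vertices, $$\liminf_{r\to\infty} \frac{\mathrm{NV}^*_{\mathfrak{X}}(r)}{|B_r|} > 0.$$ 3. For $q = 2$ and $\mathfrak{X}$ the Petersen graph, $$\liminf_{r\to\infty} \frac{\mathrm{NV}^*_{\mathfrak{X}}(r)}{|B_r|} = 0.$$ -/

import Mathlib

open MeasureTheory ProbabilityTheory Filter
open scoped NNReal ENNReal

namespace TreeOrbit

/-! ### Universal covering tree and fundamental group of a graph -/

section Cover

variable {W : Type*} {X : SimpleGraph W} {u v w : W}

/-- `PruneStep ξ ξ'`: the path `ξ'` is obtained from the path `ξ` by deleting one backtracking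
`a, b, a` (replacing it by the single vertex `a`). -/
inductive PruneStep (X : SimpleGraph W) {u v : W} : X.Walk u v → X.Walk u v → Prop
  | prune {a b : W} (η : X.Walk u a) (h : X.Adj a b) (ζ : X.Walk a v) :
      PruneStep X (η.append (.cons h (.cons h.symm ζ))) (η.append ζ)

/-- Prune-equivalence classes of paths from `u` to `v`. `Quot` passes to the equivalence relation
generated by `PruneStep`. -/
def PathClass (X : SimpleGraph W) (u v : W) : Type _ :=
  Quot (PruneStep X (u := u) (v := v))

/-- The class of a path. -/
def PathClass.mk (ξ : X.Walk u v) : PathClass X u v := Quot.mk _ ξ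

/-- Vertices of the universal covering tree of `(X, u)`: prune-equivalence classes of finite paths
in `X` that start at `u`. -/
def CoverVertex (X : SimpleGraph W) (u : W) : Type _ := Σ v : W, PathClass X u v

/-- The vertex of the covering tree given by a path. -/
def CoverVertex.mk (ξ : X.Walk u v) : CoverVertex X u := ⟨v, PathClass.mk ξ⟩

/-- The root of the covering tree: the class of the constant path. -/
def coverRoot (X : SimpleGraph W) (u : W) : CoverVertex X u :=
  CoverVertex.mk (SimpleGraph.Walk.nil : X.Walk u u)

theorem CoverVertex.mk_prune {a b : W} (η : X.Walk u a) (h : X.Adj a b) (ζ : X.Walk a v) :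
    CoverVertex.mk (η.append (.cons h (.cons h.symm ζ))) = CoverVertex.mk (η.append ζ) :=
  congrArg (Sigma.mk v) (Quot.sound (PruneStep.prune η h ζ))

theorem CoverVertex.mk_concat_concat {a : W} (η : X.Walk u v) (h : X.Adj v a) :
    CoverVertex.mk ((η.concat h).concat h.symm) = CoverVertex.mk η := by
  have := CoverVertex.mk_prune η h (SimpleGraph.Walk.nil : X.Walk v v)
  simpa [SimpleGraph.Walk.concat_eq_append, ← SimpleGraph.Walk.append_assoc] using this

/-- The universal covering tree of `(X, u)` (the rooted pruned tree): two classes are adjacent when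
one of them is the extension of the other by one edge of `X`. The relation written here is
symmetric, because extending by an edge and then by its reverse gives back the same class. -/
def coverTree (X : SimpleGraph W) (u : W) : SimpleGraph (CoverVertex X u) where
  Adj a b := ∃ (v w : W) (η : X.Walk u v) (h : X.Adj v w),
    a = CoverVertex.mk η ∧ b = CoverVertex.mk (η.concat h)
  symm := ⟨by
    rintro a b ⟨v, w, η, h, rfl, rfl⟩
    exact ⟨w, v, η.concat h, h.symm, rfl, (CoverVertex.mk_concat_concat η h).symm⟩⟩
  loopless := ⟨by
    rintro a ⟨v, w, η, h, h1, h2⟩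
    exact h.ne (congrArg Sigma.fst (h1.symm.trans h2))⟩

/-- Concatenation from the left with a closed path `α` based at `u`: `[ξ] ↦ [α.ξ]`. -/
def leftConcatFun (α : X.Walk u u) (a : CoverVertex X u) : CoverVertex X u :=
  ⟨a.1, Quot.map (fun ξ => α.append ξ) (by
    rintro _ _ ⟨η, h, ζ⟩
    rw [SimpleGraph.Walk.append_assoc, SimpleGraph.Walk.append_assoc]
    exact PruneStep.prune _ h ζ) a.2⟩

theorem leftConcatFun_mk (α : X.Walk u u) (ξ : X.Walk u v) :
    leftConcatFun α (CoverVertex.mk ξ) = CoverVertex.mk (α.append ξ) := rfl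

theorem CoverVertex.exists_mk (a : CoverVertex X u) :
    ∃ (v : W) (ξ : X.Walk u v), a = CoverVertex.mk ξ := by
  obtain ⟨v, c⟩ := a
  induction c using Quot.ind with
  | mk ξ => exact ⟨v, ξ, rfl⟩

theorem CoverVertex.mk_append_reverse {a : W} (β : X.Walk u a) (ξ : X.Walk u v) :
    CoverVertex.mk ((β.append β.reverse).append ξ) = CoverVertex.mk ξ := by
  induction β using SimpleGraph.Walk.concatRec with
  | Hnil => rfl
  | Hconcat p h ih =>
    rw [← ih ξ]
    have := CoverVertex.mk_prune p h (p.reverse.append ξ)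
    simpa [SimpleGraph.Walk.concat_eq_append, ← SimpleGraph.Walk.append_assoc] using this

theorem leftConcatFun_comp (α β : X.Walk u u) (a : CoverVertex X u) :
    leftConcatFun α (leftConcatFun β a) = leftConcatFun (α.append β) a := by
  obtain ⟨v, ξ, rfl⟩ := a.exists_mk
  simp only [leftConcatFun_mk, SimpleGraph.Walk.append_assoc]

theorem leftConcatFun_reverse (α : X.Walk u u) (a : CoverVertex X u) :
    leftConcatFun α (leftConcatFun α.reverse a) = a := by
  obtain ⟨v, ξ, rfl⟩ := a.exists_mk
  rw [leftConcatFun_comp, leftConcatFun_mk, CoverVertex.mk_append_reverse]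

theorem leftConcatFun_reverse' (α : X.Walk u u) (a : CoverVertex X u) :
    leftConcatFun α.reverse (leftConcatFun α a) = a := by
  have := leftConcatFun_reverse α.reverse a
  rwa [SimpleGraph.Walk.reverse_reverse] at this

theorem leftConcatFun_adj (α : X.Walk u u) {a b : CoverVertex X u}
    (hab : (coverTree X u).Adj a b) :
    (coverTree X u).Adj (leftConcatFun α a) (leftConcatFun α b) := by
  obtain ⟨v, w, η, h, rfl, rfl⟩ := hab
  exact ⟨v, w, α.append η, h, rfl, by
    rw [leftConcatFun_mk, SimpleGraph.Walk.append_concat]⟩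

/-- The automorphism `[ξ] ↦ [α.ξ]` of the covering tree. -/
def leftConcat (α : X.Walk u u) : coverTree X u ≃g coverTree X u where
  toFun := leftConcatFun α
  invFun := leftConcatFun α.reverse
  left_inv := leftConcatFun_reverse' α
  right_inv := leftConcatFun_reverse α
  map_rel_iff' := by
    intro a b
    refine ⟨fun h => ?_, leftConcatFun_adj α⟩
    have := leftConcatFun_adj α.reverse h
    simpa only [Equiv.coe_fn_mk, leftConcatFun_reverse'] using this

/-- The fundamental group `π₁(X, u)`, as the group of automorphisms of the covering tree given by
left concatenation with closed paths based at `u`. -/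
def fundamentalGroup (X : SimpleGraph W) (u : W) : Subgroup (coverTree X u ≃g coverTree X u) where
  carrier := Set.range leftConcat
  one_mem' := ⟨.nil, by
    ext a
    obtain ⟨v, ξ, rfl⟩ := a.exists_mk
    rfl⟩
  mul_mem' := by
    rintro _ _ ⟨α, rfl⟩ ⟨β, rfl⟩
    exact ⟨α.append β, RelIso.ext fun a => (leftConcatFun_comp α β a).symm⟩
  inv_mem' := by
    rintro _ ⟨α, rfl⟩
    refine ⟨α.reverse, RelIso.ext fun a => ?_⟩
    apply (leftConcat α).injective
    rw [RelIso.apply_inv_self]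
    exact leftConcatFun_reverse α a

/-- Transport of automorphisms along a graph isomorphism, `g ↦ i ∘ g ∘ i⁻¹`. -/
def autConj {V V' : Type*} {S : SimpleGraph V'} {T : SimpleGraph V} (i : S ≃g T) :
    (S ≃g S) →* (T ≃g T) where
  toFun g := (i.symm.trans g).trans i
  map_one' := by
    ext a
    exact i.apply_symm_apply a
  map_mul' g h := by
    ext a
    exact congrArg (fun b => i (g b)) (i.symm_apply_apply (h (i.symm a))).symm

/-- The fundamental group `Γ_X = i^* π₁(X, u)` as a group of automorphisms of a tree `T` that is
identified with the covering tree by `i`. -/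
def deckGroup {V : Type*} {T : SimpleGraph V} (X : SimpleGraph W) (u : W)
    (i : coverTree X u ≃g T) : Subgroup (T ≃g T) :=
  (fundamentalGroup X u).map (autConj i)

end Cover

/-! ### Random lattice orbits -/

section Orbit

variable {V : Type*}

/-- The topology of pointwise convergence on the automorphism group of a graph; the basic
neighbourhoods of `g` are the sets `{h | h x = g x for all x ∈ F}` with `F` finite. -/
instance autTopology (T : SimpleGraph V) : TopologicalSpace (T ≃g T) :=
  TopologicalSpace.induced (fun (g : T ≃g T) (x : V) => g x)
    (@Pi.topologicalSpace V (fun _ => V) fun _ => ⊥)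

/-- The Borel σ-algebra on the automorphism group. -/
instance autMeasurableSpace (T : SimpleGraph V) : MeasurableSpace (T ≃g T) := borel _

/-- Locally finite positive measures `p` on the discrete space `V`, identified with their mass
functions `x ↦ p({x})`, with the topology of pointwise convergence and the product σ-algebra (which
is the Borel σ-algebra, as `V` is countable in all uses). -/
abbrev Config (V : Type*) := V → ℝ≥0

/-- The measure `∑_{g ∈ hΓ} δ_{g.o}`, i.e. the orbit `hΓ.o`, as a function of the coset `hΓ`. -/
noncomputable def orbitConfig {T : SimpleGraph V} (Γ : Subgroup (T ≃g T)) (o : V)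
    (c : (T ≃g T) ⧸ Γ) : Config V :=
  fun x => ((Set.ncard {g : T ≃g T | (g : (T ≃g T) ⧸ Γ) = c ∧ g o = x} : ℕ) : ℝ≥0)

/-- `μ` is the random lattice orbit of `Γ` with base point `o`: the law of `hΓ.o`, where the coset
`hΓ` is distributed according to the invariant probability measure on `Aut(T)/Γ`.
Inversion `Γg ↦ g⁻¹Γ` identifies this with `g⁻¹Γ.o` for uniformly distributed `Γg ∈ Γ\Aut(T)`. -/
def IsRandomLatticeOrbit {T : SimpleGraph V} (Γ : Subgroup (T ≃g T)) (o : V)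
    (μ : Measure (Config V)) : Prop :=
  ∃ m : Measure ((T ≃g T) ⧸ Γ), IsProbabilityMeasure m ∧
    SMulInvariantMeasure (T ≃g T) ((T ≃g T) ⧸ Γ) m ∧ μ = m.map (orbitConfig Γ o)

/-- `μ` is the random lattice orbit in the tree `T` with root `o` that is associated with the
fundamental group of the graph `X` (with base point `u`), for some identification of the rooted
covering tree of `(X, u)` with `(T, o)`. -/
def IsFundamentalGroupOrbit {W : Type*} (X : SimpleGraph W) (u : W) (T : SimpleGraph V) (o : V)
    (μ : Measure (Config V)) : Prop :=
  ∃ i : coverTree X u ≃g T, i (coverRoot X u) = o ∧ IsRandomLatticeOrbit (deckGroup X u i) o μ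

end Orbit

/-! ### Spherical functions, diffraction measure and number variances -/

section Spherical

/-- `τ / 2 = π / log q`. -/
noncomputable def halfPeriod (q : ℕ) : ℝ := Real.pi / Real.log q

/-- The Harish-Chandra `c`-function. -/
noncomputable def cFun (q : ℕ) (z : ℂ) : ℂ :=
  1 / ((q : ℂ) ^ (1 / 2 : ℂ) + (q : ℂ) ^ (-(1 / 2) : ℂ)) *
    (((q : ℂ) ^ (1 / 2 + Complex.I * z) - (q : ℂ) ^ (-(1 / 2) - Complex.I * z)) /
      ((q : ℂ) ^ (Complex.I * z) - (q : ℂ) ^ (-(Complex.I * z))))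

open Classical in
/-- The value at distance `n` from the root of the spherical function `ω_z` of the
`(q+1)`-regular tree. The first case is `z = (τ/2) j` with `j ∈ ℤ`. -/
noncomputable def sphericalFun (q : ℕ) (z : ℂ) (n : ℕ) : ℂ :=
  if h : ∃ j : ℤ, z = (j : ℂ) * (halfPeriod q : ℂ) then
    (1 + ((q : ℂ) ^ (1 / 2 : ℂ) - (q : ℂ) ^ (-(1 / 2) : ℂ)) /
      ((q : ℂ) ^ (1 / 2 : ℂ) + (q : ℂ) ^ (-(1 / 2) : ℂ)) * n) *
      ((-1 : ℂ) ^ h.choose) ^ n * (q : ℂ) ^ (-(n : ℂ) / 2)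
  else
    cFun q z * (q : ℂ) ^ (-(1 / 2 - Complex.I * z) * n) +
      cFun q (-z) * (q : ℂ) ^ (-(1 / 2 + Complex.I * z) * n)

/-- The set `Λ_q = i[0,1/2] ∪ (0,τ/2) ∪ (τ/2 + i[0,1/2])` of spherical parameters. -/
noncomputable def spectralSet (q : ℕ) : Set ℂ :=
  {z | z.re = 0 ∧ z.im ∈ Set.Icc (0 : ℝ) (1 / 2)} ∪
    {z | z.im = 0 ∧ z.re ∈ Set.Ioo 0 (halfPeriod q)} ∪
    {z | z.re = halfPeriod q ∧ z.im ∈ Set.Icc (0 : ℝ) (1 / 2)}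

/-- The parameter `i/2` of the trivial character. -/
noncomputable def trivialParam : ℂ := Complex.I / 2

/-- The parameter `τ/2 + i/2` of the sign character. -/
noncomputable def signParam (q : ℕ) : ℂ := (halfPeriod q : ℂ) + Complex.I / 2

variable {V : Type*} (T : SimpleGraph V) (o : V)

/-- The metric ball of radius `r` around `o`. -/
def ball (r : ℕ) : Set V := {x | T.dist o x ≤ r}

/-- The spherical transform `f̂(z) = ∑ₓ f(x) ω_z(d(x,o))` of a finitely supported function on the
`(q+1)`-regular tree. -/
noncomputable def sphericalTransform (q : ℕ) (f : V → ℂ) (z : ℂ) : ℂ :=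
  ∑ᶠ x, f x * sphericalFun q z (T.dist o x)

/-- Elements of the Hecke algebra, as functions on the tree: finitely supported and radial. -/
def IsHecke (f : V → ℂ) : Prop :=
  f.support.Finite ∧ ∀ x y, T.dist o x = T.dist o y → f x = f y

/-- The linear statistic `𝕊f(p) = ∑ₓ p(x) f(x)`. -/
noncomputable def linearStatistic (f : V → ℂ) (p : Config V) : ℂ :=
  ∑ᶠ x, ((p x : ℝ) : ℂ) * f x

/-- `σ` is the diffraction measure of the point process with law `μ` on the `(q+1)`-regular tree `T`
with root `o`: a finite positive Borel measure carried by `Λ_q` with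
`⟨𝕊f₁, 𝕊f₂⟩_{L²(μ)} = ∫ f̂₁ conj(f̂₂) dσ` for all `f₁, f₂` in the Hecke algebra. -/
structure IsDiffractionMeasure (q : ℕ) (μ : Measure (Config V)) (σ : Measure ℂ) : Prop where
  finite : IsFiniteMeasure σ
  carrier : σ (spectralSet q)ᶜ = 0
  inner_eq : ∀ f₁ f₂ : V → ℂ, IsHecke T o f₁ → IsHecke T o f₂ →
    ∫ p, linearStatistic f₁ p * (starRingEnd ℂ) (linearStatistic f₂ p) ∂μ =
      ∫ z, sphericalTransform T o q f₁ z * (starRingEnd ℂ) (sphericalTransform T o q f₂ z) ∂σ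

/-- The sub-oscillatory number variance `NV*(r)` computed from the diffraction measure `σ`: the
integral of `|χ̂_{B_r}|²` over `Λ_q` without the parameters of the trivial and the sign character. -/
noncomputable def subOscNumberVariance (q : ℕ) (σ : Measure ℂ) (r : ℕ) : ℝ :=
  ∫ z in spectralSet q \ {trivialParam, signParam q},
    ‖sphericalTransform T o q ((ball T o r).indicator 1) z‖ ^ 2 ∂σ

/-- The number variance: the variance of the number of points in the ball of radius `r`. -/
noncomputable def numberVariance (μ : Measure (Config V)) (r : ℕ) : ℝ :=
  Var[fun p : Config V => ∑ᶠ x ∈ ball T o r, (p x : ℝ); μ]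

/-- `liminf_{r → ∞} F(r) / |B_r(o)|`, as an extended real number. -/
noncomputable def liminfPerVolume (F : ℕ → ℝ) : EReal :=
  liminf (fun r : ℕ => ((F r / ((ball T o r).ncard : ℝ) : ℝ) : EReal)) atTop

end Spherical

/-- The Petersen graph: an outer 5-cycle, an inner pentagram and five spokes. -/
def petersenGraph : SimpleGraph (ZMod 5 ⊕ ZMod 5) where
  Adj
    | .inl a, .inl b => b = a + 1 ∨ a = b + 1
    | .inr a, .inr b => b = a + 2 ∨ a = b + 2
    | .inl a, .inr b => a = b
    | .inr a, .inl b => a = b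
  symm := ⟨by rintro (a | a) (b | b) h <;> simp_all [or_comm]⟩
  loopless := ⟨by rintro (a | a) h <;> revert a <;> decide⟩

end TreeOrbit

/-!
# Hyperuniformity of orbits of fundamental groups in regular trees

A coset `hΓ` of the fundamental group `Γ` of a graph `X` is the same thing as a covering
`x ↦ π (h⁻¹ x)` of `X` by the tree, and the orbit `hΓ.o` is the fiber of this covering over the base
point `u` (`cosetLabel`, `orbitConfig_eq`). For a random coset the vertex of `X` below the root is
uniformly distributed (`measureReal_cosetLabel`): invariance under `Aut(T)`, which is transitive
because automorphisms of the vertex-transitive graph `X` lift (`exists_aut_apply_root`), makes its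
law a stationary measure of the simple random walk on the connected regular graph `X`.

Write the point mass at `u` as a sum of eigenfunctions `F j` of the adjacency operator of `X`, with
distinct eigenvalues `a j` (`IsSpectralDecomposition`). Pulled back to the tree, `F j` is an
eigenfunction of the adjacency operator of the tree, and so is the spherical function `ω_z`. Pairing
an element of the Hecke algebra with an eigenfunction multiplies its value at the root by a
polynomial in the eigenvalue (`sum_sphere_eigenfunction`, `HasHeckePoly`). Hence a linear statistic
`𝕊f` is `∑ j, f̂(z j) F j (v)`, with `v` the uniform vertex of `X` below the root and `z j` the
spectral parameter of `a j`. Orthogonality of the `F j` identifies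
`∑ j, F j u / |X| • δ_{z j}` as a diffraction measure. It is the only one
(`IsDiffractionMeasure.eq_atomicMeasure`): the eigenvalue is an injective function of the parameter
in `Λ_q`, so any diffraction measure is carried by the zeros `z j` of `∏ (x - a j)`, and Lagrange
interpolation determines its masses.

The number variances are thus finite combinations of squares of the polynomials `ballPoly q (a j) r`.
For a tempered eigenvalue `a = 2 √q cos θ` these are `q ^ r (C sin (r θ + φ)) ^ 2`
(`exists_ballPoly_sq_eq`), while the volume of the ball is comparable to `q ^ r`. For `a = ±1` the
angle `θ / π` is irrational by Niven's theorem, and the sine is frequently small along every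
arithmetic progression (`frequently_ballPoly_sq_le`). The complete graph has the only tempered
eigenvalue `-1`. The Petersen graph has the tempered eigenvalues `1` and `-2`, and the contribution
of `-2` vanishes for all radii `4k + 2` (`ballPoly_two_neg_two`). The complete bipartite graph has
the only tempered eigenvalue `0`, for which `θ = π / 2` and the sine stays away from zero
(`pow_le_ballPoly_zero_sq`).
-/

namespace TreeOrbit


/-! ### Sums over spheres of a regular tree -/

section Spheres

variable {V : Type*} {T : SimpleGraph V} {o : V}

open Classical in
/-- The sphere of radius `n` around `o` as a finite set. It is defined by recursion, so that no
finiteness proof is carried along; `mem_sphere` characterizes it through the distance. -/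
noncomputable def sphere (T : SimpleGraph V) [T.LocallyFinite] (o : V) : ℕ → Finset V
  | 0 => {o}
  | n + 1 => {x ∈ (sphere T o n).biUnion fun y => T.neighborFinset y | T.dist o x = n + 1}

theorem exists_adj_dist_eq (hT : T.Connected) {x : V} {n : ℕ} (h : T.dist o x = n + 1) :
    ∃ y, T.Adj x y ∧ T.dist o y = n := by
  obtain ⟨p, hp⟩ := (hT x o).exists_walk_length_eq_dist
  rw [T.dist_comm, h] at hp
  cases p with
  | nil => simp at hp
  | @cons _ y _ hxy p =>
    refine ⟨y, hxy, ?_⟩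
    have h1 : T.dist y o ≤ p.length := T.dist_le p
    have h2 : T.dist o x ≤ T.dist o y + T.dist y x := hT.dist_triangle
    rw [SimpleGraph.dist_eq_one_iff_adj.2 hxy.symm] at h2
    rw [T.dist_comm] at h1
    simp only [SimpleGraph.Walk.length_cons] at hp
    omega

theorem mem_sphere [T.LocallyFinite] (hT : T.Connected) {n : ℕ} {x : V} :
    x ∈ sphere T o n ↔ T.dist o x = n := by
  induction n generalizing x with
  | zero => simp [sphere, hT.dist_eq_zero_iff, eq_comm]
  | succ n ih =>
    simp only [sphere, Finset.mem_filter, Finset.mem_biUnion, SimpleGraph.mem_neighborFinset, ih,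
      and_iff_right_iff_imp]
    intro h
    obtain ⟨y, hxy, hy⟩ := exists_adj_dist_eq hT h
    exact ⟨y, hy, hxy.symm⟩

theorem eq_of_adj_of_dist_eq (hT : T.IsTree) {x y y' : V} {n : ℕ} (hx : T.dist o x = n + 1)
    (hy : T.Adj y x) (hy' : T.Adj y' x) (hn : T.dist o y = n) (hn' : T.dist o y' = n) :
    y = y' := by
  obtain ⟨p, hp⟩ := (hT.connected o y).exists_walk_length_eq_dist
  obtain ⟨p', hp'⟩ := (hT.connected o y').exists_walk_length_eq_dist
  have h1 : (p.concat hy).IsPath :=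
    SimpleGraph.Walk.isPath_of_length_eq_dist _ (by rw [SimpleGraph.Walk.length_concat]; omega)
  have h2 : (p'.concat hy').IsPath :=
    SimpleGraph.Walk.isPath_of_length_eq_dist _ (by rw [SimpleGraph.Walk.length_concat]; omega)
  have := congrArg SimpleGraph.Walk.penultimate
    (congrArg Subtype.val ((hT.isAcyclic.subsingleton_path _ _).elim ⟨_, h1⟩ ⟨_, h2⟩))
  simpa using this

open Classical in
theorem card_neighbors_toward [T.LocallyFinite] (hT : T.IsTree) {x : V} {n : ℕ}
    (hx : T.dist o x = n + 1) :
    ({y ∈ T.neighborFinset x | T.dist o y = n}).card = 1 := by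
  obtain ⟨y, hxy, hy⟩ := exists_adj_dist_eq hT.connected hx
  refine Finset.card_eq_one.2 ⟨y, Finset.eq_singleton_iff_unique_mem.2 ⟨by simp [hxy, hy], ?_⟩⟩
  intro z hz
  simp only [Finset.mem_filter, SimpleGraph.mem_neighborFinset] at hz
  exact eq_of_adj_of_dist_eq hT hx hz.1.symm hxy.symm hz.2 hy

open Classical in
/-- In a tree a neighbor is never at the same distance from the root, so the neighbors split into
those one step closer to the root and those one step farther away. -/
theorem sum_neighbors_eq [T.LocallyFinite] {R : Type*} [AddCommMonoid R] (hT : T.IsTree) {x : V}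
    {n : ℕ} (hx : T.dist o x = n + 1) (f : V → R) :
    ∑ y ∈ T.neighborFinset x, f y = ∑ y ∈ T.neighborFinset x with T.dist o y = n, f y +
      ∑ y ∈ T.neighborFinset x with T.dist o y = n + 2, f y := by
  rw [← Finset.sum_filter_add_sum_filter_not _ (fun y => T.dist o y = n)]
  congr 1
  refine Finset.sum_congr (Finset.filter_congr fun y hy => ?_) fun _ _ => rfl
  have := hT.dist_eq_dist_add_one_of_adj o ((T.mem_neighborFinset x y).1 hy)
  omega

open Classical in
theorem card_neighbors_away [T.LocallyFinite] {q : ℕ} (hT : T.IsTree)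
    (hreg : T.IsRegularOfDegree (q + 1)) {x : V} {n : ℕ} (hx : T.dist o x = n + 1) :
    ({y ∈ T.neighborFinset x | T.dist o y = n + 2}).card = q := by
  have h := sum_neighbors_eq hT hx (fun _ => 1)
  simp only [← Finset.card_eq_sum_ones, card_neighbors_toward hT hx,
    SimpleGraph.card_neighborFinset_eq_degree, hreg.degree_eq] at h
  omega

open Classical in
theorem card_neighbors_root [T.LocallyFinite] {q : ℕ} (hreg : T.IsRegularOfDegree (q + 1)) :
    ({y ∈ T.neighborFinset o | T.dist o y = 1}).card = q + 1 := by
  rw [Finset.filter_true_of_mem, SimpleGraph.card_neighborFinset_eq_degree, hreg.degree_eq]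
  intro y hy
  exact SimpleGraph.dist_eq_one_iff_adj.2 ((T.mem_neighborFinset o y).1 hy)

/-- The polynomials (evaluated at `a`) with which the sphere operators of the `(q+1)`-regular tree
are polynomials in the adjacency operator. -/
def spherePoly {R : Type*} [CommRing R] (q : ℕ) (a : R) : ℕ → R
  | 0 => 1
  | 1 => a
  | 2 => a ^ 2 - (q + 1)
  | n + 3 => a * spherePoly q a (n + 2) - q * spherePoly q a (n + 1)

open Classical in
theorem sum_sphere_sum_neighbors [T.LocallyFinite] {R : Type*} [CommRing R] (hT : T.IsTree)
    (n : ℕ) (f : V → R) :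
    ∑ x ∈ sphere T o (n + 1), ∑ y ∈ T.neighborFinset x, f y =
      ∑ x ∈ sphere T o (n + 2), f x +
      ∑ x ∈ sphere T o n, ({y ∈ T.neighborFinset x | T.dist o y = n + 1}).card * f x := by
  have h : ∀ x ∈ sphere T o (n + 1), ∑ y ∈ T.neighborFinset x, f y = _ := fun x hx =>
    sum_neighbors_eq hT ((mem_sphere hT.connected).1 hx) f
  rw [Finset.sum_congr rfl h, Finset.sum_add_distrib, add_comm]
  congr 1
  · rw [Finset.sum_comm' (t' := sphere T o (n + 2))
      (s' := fun x => {y ∈ T.neighborFinset x | T.dist o y = n + 1})]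
    · refine Finset.sum_congr rfl fun x hx => ?_
      rw [Finset.sum_const, card_neighbors_toward hT ((mem_sphere hT.connected).1 hx), one_smul]
    · intro x y
      simp only [mem_sphere hT.connected, Finset.mem_filter, SimpleGraph.mem_neighborFinset,
        T.adj_comm x y]
      tauto
  · rw [Finset.sum_comm' (t' := sphere T o n)
      (s' := fun x => {y ∈ T.neighborFinset x | T.dist o y = n + 1})]
    · simp
    · intro x y
      simp only [mem_sphere hT.connected, Finset.mem_filter, SimpleGraph.mem_neighborFinset,
        T.adj_comm x y]
      tauto

/-- An eigenfunction of the adjacency operator is an eigenfunction of all sphere operators. -/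
theorem sum_sphere_eigenfunction [T.LocallyFinite] {R : Type*} [CommRing R] {q : ℕ} (hT : T.IsTree)
    (hreg : T.IsRegularOfDegree (q + 1)) {a : R} {f : V → R}
    (hf : ∀ x, ∑ y ∈ T.neighborFinset x, f y = a * f x) (n : ℕ) :
    ∑ x ∈ sphere T o n, f x = spherePoly q a n * f o := by
  classical
  have h0 : ∑ x ∈ sphere T o 0, f x = f o := by simp [sphere]
  have h1 : ∑ x ∈ sphere T o 1, f x = a * f o := by
    rw [← hf]
    refine Finset.sum_congr ?_ fun _ _ => rfl
    ext x
    rw [mem_sphere hT.connected, SimpleGraph.dist_eq_one_iff_adj, SimpleGraph.mem_neighborFinset]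
  have hrec : ∀ n, a * ∑ x ∈ sphere T o (n + 1), f x =
      ∑ x ∈ sphere T o (n + 2), f x +
      ∑ x ∈ sphere T o n, ({y ∈ T.neighborFinset x | T.dist o y = n + 1}).card * f x := fun n => by
    rw [← sum_sphere_sum_neighbors hT, Finset.mul_sum]
    exact Finset.sum_congr rfl fun x _ => (hf x).symm
  induction n using Nat.strong_induction_on with
  | _ n ih =>
  match n with
  | 0 => simp [spherePoly, h0]
  | 1 => simp [spherePoly, h1]
  | 2 =>
    have h := hrec 0
    rw [h1] at h
    simp only [sphere.eq_1, zero_add, Finset.sum_singleton, card_neighbors_root hreg] at h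
    push_cast at h
    simp only [spherePoly]
    linear_combination -h
  | n + 3 =>
    have h := hrec (n + 1)
    have hc : ∀ x ∈ sphere T o (n + 1),
        (({y ∈ T.neighborFinset x | T.dist o y = n + 1 + 1}).card : R) * f x = q * f x :=
      fun x hx => by
        rw [card_neighbors_away hT hreg ((mem_sphere hT.connected).1 hx)]
    rw [Finset.sum_congr rfl hc, ← Finset.mul_sum, ih (n + 1) (by omega),
      ih (n + 1 + 1) (by omega)] at h
    simp only [spherePoly]
    linear_combination -h

theorem card_sphere [T.LocallyFinite] {R : Type*} [CommRing R] {q : ℕ} (hT : T.IsTree)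
    (hreg : T.IsRegularOfDegree (q + 1)) (n : ℕ) :
    ((sphere T o n).card : R) = spherePoly q (q + 1 : R) n := by
  have := sum_sphere_eigenfunction (R := R) (o := o) (f := fun _ => 1) (a := q + 1) hT hreg
    (fun x => by simp [hreg.degree_eq]) n
  simpa using this

theorem spherePoly_degree {R : Type*} [CommRing R] (q n : ℕ) :
    spherePoly q (q + 1 : R) (n + 1) = (q + 1) * q ^ n := by
  induction n using Nat.strong_induction_on with
  | _ n ih =>
  match n with
  | 0 => simp [spherePoly]
  | 1 => simp only [spherePoly]; ring
  | n + 2 =>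
    rw [spherePoly, ih n (by omega), ih (n + 1) (by omega)]
    ring

/-- The value at `a` of the spherical transform of the indicator of the ball of radius `n`, as a
polynomial in the eigenvalue `a`. -/
def ballPoly {R : Type*} [CommRing R] (q : ℕ) (a : R) (n : ℕ) : R :=
  ∑ k ∈ Finset.range (n + 1), spherePoly q a k

theorem ballPoly_zero {R : Type*} [CommRing R] (q : ℕ) (a : R) : ballPoly q a 0 = 1 := by
  simp [ballPoly, spherePoly]

theorem ballPoly_one {R : Type*} [CommRing R] (q : ℕ) (a : R) : ballPoly q a 1 = 1 + a := by
  simp [ballPoly, Finset.sum_range_succ, spherePoly]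

theorem ballPoly_add_two {R : Type*} [CommRing R] (q : ℕ) (a : R) (n : ℕ) :
    ballPoly q a (n + 2) = a * ballPoly q a (n + 1) - q * ballPoly q a n := by
  induction n with
  | zero => simp [ballPoly, Finset.sum_range_succ, spherePoly]; ring
  | succ n ih =>
    have h : ∀ m, ballPoly q a (m + 1) = ballPoly q a m + spherePoly q a (m + 1) := fun m =>
      Finset.sum_range_succ _ _
    have h1 := h n
    have h2 := h (n + 1)
    have h3 := h (n + 2)
    rw [spherePoly] at h3
    linear_combination h3 + ih + a * (-h2) + q * h1

theorem map_spherePoly {R S : Type*} [CommRing R] [CommRing S] (φ : R →+* S) (q : ℕ) (a : R)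
    (n : ℕ) : φ (spherePoly q a n) = spherePoly q (φ a) n := by
  induction n using Nat.strong_induction_on with
  | _ n ih =>
  match n with
  | 0 => simp [spherePoly]
  | 1 => simp [spherePoly]
  | 2 => simp [spherePoly]
  | n + 3 => simp [spherePoly, ih (n + 1) (by omega), ih (n + 2) (by omega)]

theorem map_ballPoly {R S : Type*} [CommRing R] [CommRing S] (φ : R →+* S) (q : ℕ) (a : R)
    (n : ℕ) : φ (ballPoly q a n) = ballPoly q (φ a) n := by
  simp [ballPoly, map_spherePoly]

/-- A lower bound for the volume of balls, with the order of growth `q ^ n`. -/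
theorem pow_le_ballPoly (q n : ℕ) : (q : ℝ) ^ n ≤ ballPoly q (q + 1 : ℝ) n := by
  have h : ∀ k, 0 ≤ spherePoly q (q + 1 : ℝ) k := fun k => by
    cases k with
    | zero => simp [spherePoly]
    | succ k => rw [spherePoly_degree]; positivity
  refine le_trans ?_ (Finset.single_le_sum (fun k _ => h k) (Finset.self_mem_range_succ n))
  cases n with
  | zero => simp [spherePoly]
  | succ k =>
    rw [spherePoly_degree, pow_succ']
    gcongr
    linarith

theorem ballPoly_le {q : ℕ} (hq : 2 ≤ q) (n : ℕ) : ballPoly q (q + 1 : ℝ) n ≤ 3 * (q : ℝ) ^ n := by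
  have hq' : (2 : ℝ) ≤ q := by exact_mod_cast hq
  induction n with
  | zero => norm_num [ballPoly_zero]
  | succ n ih =>
    have h : ballPoly q (q + 1 : ℝ) (n + 1) =
      ballPoly q (q + 1 : ℝ) n + (q + 1) * q ^ n := by
        rw [← spherePoly_degree]; exact Finset.sum_range_succ _ _
    rw [h, pow_succ]
    nlinarith [pow_pos (show (0 : ℝ) < q by linarith) n]

end Spheres


/-! ### Spherical functions and eigenvalues of the adjacency operator -/

section SphericalFunctions

/-- The eigenvalue of the adjacency operator of the `(q+1)`-regular tree on the spherical function
with parameter `z`. -/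
noncomputable def adjEigenvalue (q : ℕ) (z : ℂ) : ℂ :=
  2 * (√(q : ℝ) : ℝ) * Complex.cos (z * (Real.log q : ℝ))

theorem cpow_half (q : ℕ) : (q : ℂ) ^ (1 / 2 : ℂ) = ((√(q : ℝ) : ℝ) : ℂ) := by
  rw [Real.sqrt_eq_rpow, Complex.ofReal_cpow (by positivity)]
  norm_num

theorem sqrt_ofReal_sq (q : ℕ) : ((√(q : ℝ) : ℝ) : ℂ) ^ 2 = q := by
  rw [← Complex.ofReal_pow, Real.sq_sqrt (by positivity)]
  simp

theorem sqrt_ofReal_ne_zero {q : ℕ} (hq : 2 ≤ q) : ((√(q : ℝ) : ℝ) : ℂ) ≠ 0 := by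
  rw [Complex.ofReal_ne_zero, Real.sqrt_ne_zero']
  exact_mod_cast (by omega : 0 < q)

theorem halfPeriod_mul_log {q : ℕ} (hq : 2 ≤ q) : halfPeriod q * Real.log q = Real.pi := by
  have : Real.log q ≠ 0 := (Real.log_pos (by exact_mod_cast hq)).ne'
  rw [halfPeriod]
  field_simp

theorem cpow_I_mul {q : ℕ} (hq : 2 ≤ q) (z : ℂ) :
    (q : ℂ) ^ (Complex.I * z) = Complex.exp (z * (Real.log q : ℝ) * Complex.I) := by
  rw [Complex.cpow_def_of_ne_zero (by exact_mod_cast (by omega : q ≠ 0)), Complex.natCast_log]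
  congr 1
  ring

theorem adjEigenvalue_eq {q : ℕ} (hq : 2 ≤ q) (z : ℂ) :
    adjEigenvalue q z =
      (√(q : ℝ) : ℝ) * ((q : ℂ) ^ (Complex.I * z) + ((q : ℂ) ^ (Complex.I * z))⁻¹) := by
  rw [adjEigenvalue, cpow_I_mul hq, ← Complex.exp_neg, Complex.cos]
  ring_nf

theorem cpow_I_mul_sq_ne_one {q : ℕ} (hq : 2 ≤ q) {z : ℂ}
    (hz : ¬ ∃ j : ℤ, z = (j : ℂ) * (halfPeriod q : ℂ)) :
    ((q : ℂ) ^ (Complex.I * z)) ^ 2 ≠ 1 := by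
  intro h
  rw [cpow_I_mul hq, ← Complex.exp_nat_mul, Complex.exp_eq_one_iff] at h
  obtain ⟨j, hj⟩ := h
  refine hz ⟨j, ?_⟩
  have hL : ((Real.log q : ℝ) : ℂ) ≠ 0 :=
    Complex.ofReal_ne_zero.2 (Real.log_pos (by exact_mod_cast hq)).ne'
  have hp : (halfPeriod q : ℂ) * (Real.log q : ℝ) = Real.pi := by
    rw [← Complex.ofReal_mul, halfPeriod_mul_log hq]
  apply mul_right_cancel₀ hL
  have h2 : (2 * Complex.I) ≠ 0 := mul_ne_zero two_ne_zero Complex.I_ne_zero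
  apply mul_left_cancel₀ h2
  rw [Nat.cast_ofNat] at hj
  linear_combination hj - 2 * Complex.I * j * hp

theorem sphericalFun_generic {q : ℕ} (hq : 2 ≤ q) {z : ℂ}
    (hz : ¬ ∃ j : ℤ, z = (j : ℂ) * (halfPeriod q : ℂ)) (n : ℕ) {s t : ℂ}
    (hs : s = (√(q : ℝ) : ℝ)) (ht : t = (q : ℂ) ^ (Complex.I * z)) :
    sphericalFun q z n =
      1 / (s + s⁻¹) * ((s * t - s⁻¹ * t⁻¹) / (t - t⁻¹)) * (s⁻¹ * t) ^ n +
      1 / (s + s⁻¹) * ((s * t⁻¹ - s⁻¹ * t) / (t⁻¹ - t)) * (s⁻¹ * t⁻¹) ^ n := by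
  have hq0 : (q : ℂ) ≠ 0 := by exact_mod_cast (by omega : q ≠ 0)
  rw [sphericalFun, dif_neg hz, cFun, cFun, Complex.cpow_mul_nat, Complex.cpow_mul_nat]
  simp only [mul_neg, neg_neg, sub_neg_eq_add, neg_sub, neg_add]
  rw [show Complex.I * z - 1 / 2 = -(1 / 2) + Complex.I * z by ring]
  simp only [sub_eq_add_neg, Complex.cpow_add _ _ hq0, Complex.cpow_neg, cpow_half, ← hs, ← ht]

theorem sphericalFun_degenerate {q : ℕ} {z : ℂ}
    (hz : ∃ j : ℤ, z = (j : ℂ) * (halfPeriod q : ℂ)) (n : ℕ) {s : ℂ}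
    (hs : s = (√(q : ℝ) : ℝ)) :
    sphericalFun q z n =
      (1 + (s - s⁻¹) / (s + s⁻¹) * n) * ((-1 : ℂ) ^ hz.choose) ^ n * s⁻¹ ^ n := by
  rw [sphericalFun, dif_pos hz, show -(n : ℂ) / 2 = -(1 / 2 : ℂ) * n by ring,
    Complex.cpow_mul_nat, Complex.cpow_neg, cpow_half, ← hs]

theorem adjEigenvalue_degenerate {q : ℕ} (hq : 2 ≤ q) {z : ℂ}
    (hz : ∃ j : ℤ, z = (j : ℂ) * (halfPeriod q : ℂ)) :
    adjEigenvalue q z = 2 * (√(q : ℝ) : ℝ) * (-1 : ℂ) ^ hz.choose := by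
  rw [adjEigenvalue]
  congr 1
  conv_lhs => rw [hz.choose_spec]
  rw [mul_assoc, ← Complex.ofReal_mul, halfPeriod_mul_log hq, ← Complex.ofReal_intCast,
    ← Complex.ofReal_mul, ← Complex.ofReal_cos, Real.cos_int_mul_pi]
  simp

theorem sphericalFun_zero {q : ℕ} (hq : 2 ≤ q) (z : ℂ) : sphericalFun q z 0 = 1 := by
  by_cases hz : ∃ j : ℤ, z = (j : ℂ) * (halfPeriod q : ℂ)
  · rw [sphericalFun_degenerate hz 0 rfl]
    simp
  · rw [sphericalFun_generic hq hz 0 rfl rfl]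
    have hs := sqrt_ofReal_ne_zero hq
    have hs2 := sqrt_ofReal_sq q
    have ht2 := cpow_I_mul_sq_ne_one hq hz
    have ht : (q : ℂ) ^ (Complex.I * z) ≠ 0 := by
      rw [cpow_I_mul hq]; exact Complex.exp_ne_zero _
    set s : ℂ := ((√(q : ℝ) : ℝ) : ℂ)
    set t : ℂ := (q : ℂ) ^ (Complex.I * z)
    have h1 : s ^ 2 + 1 ≠ 0 := by rw [hs2]; exact_mod_cast (by omega : q + 1 ≠ 0)
    have h2 : t ^ 2 - 1 ≠ 0 := sub_ne_zero.2 ht2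
    have h3 : 1 - t ^ 2 ≠ 0 := sub_ne_zero.2 ht2.symm
    have e1 : s + s⁻¹ = (s ^ 2 + 1) / s := by field_simp
    have e2 : t - t⁻¹ = (t ^ 2 - 1) / t := by field_simp
    have e3 : t⁻¹ - t = -((t ^ 2 - 1) / t) := by rw [← e2]; ring
    rw [e1, e2, e3]
    field_simp
    ring

theorem sphericalFun_one {q : ℕ} (hq : 2 ≤ q) (z : ℂ) :
    (q + 1 : ℂ) * sphericalFun q z 1 = adjEigenvalue q z := by
  have hs := sqrt_ofReal_ne_zero hq
  have hs2 := sqrt_ofReal_sq q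
  by_cases hz : ∃ j : ℤ, z = (j : ℂ) * (halfPeriod q : ℂ)
  · rw [sphericalFun_degenerate hz 1 rfl, adjEigenvalue_degenerate hq hz]
    generalize (-1 : ℂ) ^ hz.choose = e
    set s : ℂ := ((√(q : ℝ) : ℝ) : ℂ)
    have h1 : s ^ 2 + 1 ≠ 0 := by rw [hs2]; exact_mod_cast (by omega : q + 1 ≠ 0)
    have e1 : s + s⁻¹ = (s ^ 2 + 1) / s := by field_simp
    rw [e1, ← hs2]
    push_cast
    field_simp
    ring
  · rw [sphericalFun_generic hq hz 1 rfl rfl, adjEigenvalue_eq hq]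
    have ht2 := cpow_I_mul_sq_ne_one hq hz
    have ht : (q : ℂ) ^ (Complex.I * z) ≠ 0 := by
      rw [cpow_I_mul hq]; exact Complex.exp_ne_zero _
    set s : ℂ := ((√(q : ℝ) : ℝ) : ℂ)
    set t : ℂ := (q : ℂ) ^ (Complex.I * z)
    have h1 : s ^ 2 + 1 ≠ 0 := by rw [hs2]; exact_mod_cast (by omega : q + 1 ≠ 0)
    have h2 : t ^ 2 - 1 ≠ 0 := sub_ne_zero.2 ht2
    have e1 : s + s⁻¹ = (s ^ 2 + 1) / s := by field_simp
    have e2 : t - t⁻¹ = (t ^ 2 - 1) / t := by field_simp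
    have e3 : t⁻¹ - t = -((t ^ 2 - 1) / t) := by rw [← e2]; ring
    rw [e1, e2, e3, ← hs2]
    field_simp
    ring

theorem sphericalFun_add_two {q : ℕ} (hq : 2 ≤ q) (z : ℂ) (n : ℕ) :
    adjEigenvalue q z * sphericalFun q z (n + 1) =
      sphericalFun q z n + q * sphericalFun q z (n + 2) := by
  have hs := sqrt_ofReal_ne_zero hq
  have hs2 := sqrt_ofReal_sq q
  by_cases hz : ∃ j : ℤ, z = (j : ℂ) * (halfPeriod q : ℂ)
  · simp only [sphericalFun_degenerate hz _ rfl, adjEigenvalue_degenerate hq hz]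
    have he : ((-1 : ℂ) ^ hz.choose) ^ 2 = 1 := by
      rcases Int.even_or_odd hz.choose with h | h
      · simp [h.neg_one_zpow]
      · simp [h.neg_one_zpow]
    set s : ℂ := ((√(q : ℝ) : ℝ) : ℂ)
    set e : ℂ := (-1 : ℂ) ^ hz.choose
    generalize (s - s⁻¹) / (s + s⁻¹) = k
    have h1 : s * s⁻¹ = 1 := mul_inv_cancel₀ hs
    rw [← hs2]
    push_cast
    set r := s⁻¹
    have h2 : s ^ 2 * r ^ 2 = 1 := by rw [← mul_pow, h1, one_pow]
    simp only [pow_add, pow_one, he]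
    linear_combination (2 * (1 + k * (n + 1)) * e ^ n * r ^ n) * (h1 * e ^ 2 + he) -
      (1 + k * (n + 2)) * e ^ n * r ^ n * h2
  · simp only [sphericalFun_generic hq hz _ rfl rfl, adjEigenvalue_eq hq]
    have ht : (q : ℂ) ^ (Complex.I * z) ≠ 0 := by
      rw [cpow_I_mul hq]; exact Complex.exp_ne_zero _
    set s : ℂ := ((√(q : ℝ) : ℝ) : ℂ)
    set t : ℂ := (q : ℂ) ^ (Complex.I * z)
    generalize 1 / (s + s⁻¹) * ((s * t - s⁻¹ * t⁻¹) / (t - t⁻¹)) = c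
    generalize 1 / (s + s⁻¹) * ((s * t⁻¹ - s⁻¹ * t) / (t⁻¹ - t)) = c'
    have h1 : s * s⁻¹ = 1 := mul_inv_cancel₀ hs
    have h2 : t * t⁻¹ = 1 := mul_inv_cancel₀ ht
    rw [← hs2]
    set r := s⁻¹
    set t' := t⁻¹
    have ha : s * (t + t') * (r * t) = 1 + s ^ 2 * (r * t) ^ 2 := by
      linear_combination (t ^ 2 + t * t' - t ^ 2 * (s * r + 1)) * h1 + h2
    have hb : s * (t + t') * (r * t') = 1 + s ^ 2 * (r * t') ^ 2 := by
      linear_combination (t' ^ 2 + t * t' - t' ^ 2 * (s * r + 1)) * h1 + h2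
    simp only [pow_add, pow_one]
    linear_combination c * (r * t) ^ n * ha + c' * (r * t') ^ n * hb

/-- The spherical function is a radial eigenfunction of the adjacency operator of the tree. -/
theorem sum_neighbors_sphericalFun {V : Type*} {T : SimpleGraph V} [T.LocallyFinite] {o : V}
    {q : ℕ} (hq : 2 ≤ q) (hT : T.IsTree) (hreg : T.IsRegularOfDegree (q + 1)) (z : ℂ) (x : V) :
    ∑ y ∈ T.neighborFinset x, sphericalFun q z (T.dist o y) =
      adjEigenvalue q z * sphericalFun q z (T.dist o x) := by
  classical
  cases hx : T.dist o x with
  | zero =>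
    obtain rfl := hT.connected.dist_eq_zero_iff.1 hx
    rw [sphericalFun_zero hq, mul_one, ← sphericalFun_one hq,
      Finset.sum_congr rfl (g := fun _ => sphericalFun q z 1)]
    · rw [Finset.sum_const, SimpleGraph.card_neighborFinset_eq_degree, hreg.degree_eq]
      simp
    · intro y hy
      rw [SimpleGraph.dist_eq_one_iff_adj.2 ((T.mem_neighborFinset o y).1 hy)]
  | succ n =>
    have h : ∀ k, ∑ y ∈ T.neighborFinset x with T.dist o y = k, sphericalFun q z (T.dist o y) =
        ({y ∈ T.neighborFinset x | T.dist o y = k}).card * sphericalFun q z k := fun k => by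
      rw [Finset.sum_congr rfl fun y hy => by rw [(Finset.mem_filter.1 hy).2], Finset.sum_const,
        nsmul_eq_mul]
    rw [sum_neighbors_eq hT hx, h, h, card_neighbors_toward hT hx, card_neighbors_away hT hreg hx,
      sphericalFun_add_two hq]
    simp

/-! ### The spectral set -/

theorem continuous_adjEigenvalue (q : ℕ) : Continuous (adjEigenvalue q) := by
  unfold adjEigenvalue
  fun_prop

theorem adjEigenvalue_ofReal (q : ℕ) (x : ℝ) :
    adjEigenvalue q x = ((2 * √(q : ℝ) * Real.cos (x * Real.log q) : ℝ) : ℂ) := by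
  simp [adjEigenvalue]

theorem adjEigenvalue_mul_I (q : ℕ) (y : ℝ) :
    adjEigenvalue q (y * Complex.I) = ((2 * √(q : ℝ) * Real.cosh (y * Real.log q) : ℝ) : ℂ) := by
  rw [adjEigenvalue, mul_right_comm (y : ℂ), ← Complex.ofReal_mul, Complex.cos_mul_I]
  simp

theorem adjEigenvalue_halfPeriod_add {q : ℕ} (hq : 2 ≤ q) (y : ℝ) :
    adjEigenvalue q (halfPeriod q + y * Complex.I) =
      ((-(2 * √(q : ℝ) * Real.cosh (y * Real.log q)) : ℝ) : ℂ) := by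
  have h := adjEigenvalue_mul_I q y
  rw [adjEigenvalue] at h ⊢
  rw [add_mul, ← Complex.ofReal_mul (halfPeriod q), halfPeriod_mul_log hq, add_comm,
    Complex.cos_add_pi, mul_neg, h, Complex.ofReal_neg]

/-- The three pieces of the spectral set, with the corresponding real eigenvalues. -/
theorem mem_spectralSet_cases {q : ℕ} (hq : 2 ≤ q) {z : ℂ} (hz : z ∈ spectralSet q) :
    (∃ y : ℝ, 0 ≤ y ∧ z = y * Complex.I ∧
      adjEigenvalue q z = ((2 * √(q : ℝ) * Real.cosh (y * Real.log q) : ℝ) : ℂ)) ∨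
    (∃ x : ℝ, x * Real.log q ∈ Set.Ioo 0 Real.pi ∧ z = x ∧
      adjEigenvalue q z = ((2 * √(q : ℝ) * Real.cos (x * Real.log q) : ℝ) : ℂ)) ∨
    (∃ y : ℝ, 0 ≤ y ∧ z = halfPeriod q + y * Complex.I ∧
      adjEigenvalue q z = ((-(2 * √(q : ℝ) * Real.cosh (y * Real.log q)) : ℝ) : ℂ)) := by
  have hL : 0 < Real.log q := Real.log_pos (by exact_mod_cast hq)
  rcases hz with (⟨h1, h2⟩ | ⟨h1, h2⟩) | ⟨h1, h2⟩
  · have hz : z = z.im * Complex.I := by apply Complex.ext <;> simp [h1]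
    exact .inl ⟨z.im, h2.1, hz, by rw [hz]; simpa using adjEigenvalue_mul_I q z.im⟩
  · have hz : z = z.re := by apply Complex.ext <;> simp [h1]
    refine .inr (.inl ⟨z.re, ⟨mul_pos h2.1 hL, ?_⟩, hz, ?_⟩)
    · rw [← halfPeriod_mul_log hq]
      exact mul_lt_mul_of_pos_right h2.2 hL
    · rw [hz]; simpa using adjEigenvalue_ofReal q z.re
  · have hz : z = halfPeriod q + z.im * Complex.I := by apply Complex.ext <;> simp [h1]
    exact .inr (.inr ⟨z.im, h2.1, hz, by
      conv_lhs => rw [hz]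
      exact adjEigenvalue_halfPeriod_add hq z.im⟩)

theorem adjEigenvalue_injOn {q : ℕ} (hq : 2 ≤ q) :
    Set.InjOn (adjEigenvalue q) (spectralSet q) := by
  have hL : 0 < Real.log q := Real.log_pos (by exact_mod_cast hq)
  have hs : 0 < 2 * √(q : ℝ) := by
    have : (0 : ℝ) < q := by exact_mod_cast (by omega : 0 < q)
    positivity
  have hcosh : ∀ y y' : ℝ, 0 ≤ y → 0 ≤ y' →
      Real.cosh (y * Real.log q) = Real.cosh (y' * Real.log q) → y = y' := fun y y' hy hy' h => by
    have := Real.cosh_strictMonoOn.injOn (Set.mem_Ici.2 (mul_nonneg hy hL.le))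
      (Set.mem_Ici.2 (mul_nonneg hy' hL.le)) h
    exact mul_right_cancel₀ hL.ne' this
  have hcos : ∀ x : ℝ, x ∈ Set.Ioo 0 Real.pi → Real.cos x < 1 ∧ -1 < Real.cos x := fun x hx => by
    refine ⟨Real.cos_zero ▸ ?_, Real.cos_pi ▸ ?_⟩
    exacts [Real.strictAntiOn_cos ⟨le_rfl, Real.pi_pos.le⟩ ⟨hx.1.le, hx.2.le⟩ hx.1,
      Real.strictAntiOn_cos ⟨hx.1.le, hx.2.le⟩ ⟨Real.pi_pos.le, le_rfl⟩ hx.2]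
  intro z hz z' hz' h
  rcases mem_spectralSet_cases hq hz with ⟨y, hy, rfl, e⟩ | ⟨x, hx, rfl, e⟩ | ⟨y, hy, rfl, e⟩ <;>
  rcases mem_spectralSet_cases hq hz' with
    ⟨y', hy', rfl, e'⟩ | ⟨x', hx', rfl, e'⟩ | ⟨y', hy', rfl, e'⟩ <;>
  rw [e, e', Complex.ofReal_inj] at h
  · rw [hcosh y y' hy hy' (mul_left_cancel₀ hs.ne' h)]
  · have := mul_left_cancel₀ hs.ne' h
    linarith [Real.one_le_cosh (y * Real.log q), (hcos _ hx').1]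
  · nlinarith [Real.one_le_cosh (y * Real.log q), Real.one_le_cosh (y' * Real.log q)]
  · have := mul_left_cancel₀ hs.ne' h
    linarith [Real.one_le_cosh (y' * Real.log q), (hcos _ hx).1]
  · have := Real.injOn_cos ⟨hx.1.le, hx.2.le⟩ ⟨hx'.1.le, hx'.2.le⟩ (mul_left_cancel₀ hs.ne' h)
    rw [mul_right_cancel₀ hL.ne' this]
  · have := mul_left_cancel₀ hs.ne' (h.trans (mul_neg _ _).symm)
    linarith [Real.one_le_cosh (y' * Real.log q), (hcos _ hx).2]
  · nlinarith [Real.one_le_cosh (y * Real.log q), Real.one_le_cosh (y' * Real.log q)]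
  · have := mul_left_cancel₀ hs.ne' ((mul_neg _ _).trans h)
    linarith [Real.one_le_cosh (y * Real.log q), (hcos _ hx').2]
  · rw [hcosh y y' hy hy' (mul_left_cancel₀ hs.ne' (neg_injective h))]

theorem spectralSet_subset_closedBall {q : ℕ} (hq : 2 ≤ q) :
    spectralSet q ⊆ Metric.closedBall 0 (halfPeriod q + 1 / 2) := by
  have hL : 0 < Real.log q := Real.log_pos (by exact_mod_cast hq)
  have hp : 0 < halfPeriod q := div_pos Real.pi_pos hL
  intro z hz
  rw [mem_closedBall_zero_iff]
  refine (Complex.norm_le_abs_re_add_abs_im z).trans ?_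
  rcases hz with (⟨h1, h2, h3⟩ | ⟨h1, h2, h3⟩) | ⟨h1, h2, h3⟩
  · rw [h1, abs_zero, abs_of_nonneg h2]; linarith
  · rw [h1, abs_zero, abs_of_pos h2]; linarith
  · rw [h1, abs_of_pos hp, abs_of_nonneg h2]; linarith

theorem measurableSet_spectralSet (q : ℕ) : MeasurableSet (spectralSet q) := by
  have h : ∀ (a : ℝ), MeasurableSet {z : ℂ | z.re = a} := fun a =>
    Complex.measurable_re (measurableSet_singleton a)
  refine ((MeasurableSet.inter (h _) (Complex.measurable_im measurableSet_Icc)).union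
    (MeasurableSet.inter (Complex.measurable_im (measurableSet_singleton 0))
      (Complex.measurable_re measurableSet_Ioo))).union
    (MeasurableSet.inter (h _) (Complex.measurable_im measurableSet_Icc))

theorem two_mul_sqrt_mul_cosh {q : ℕ} (hq : 2 ≤ q) :
    2 * √(q : ℝ) * Real.cosh (1 / 2 * Real.log q) = q + 1 := by
  have hq0 : (0 : ℝ) < q := by exact_mod_cast (by omega : 0 < q)
  have h : Real.exp (1 / 2 * Real.log q) = √(q : ℝ) := by
    rw [Real.sqrt_eq_rpow, Real.rpow_def_of_pos hq0, mul_comm]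
  rw [Real.cosh_eq, Real.exp_neg, h]
  have hs : √(q : ℝ) ≠ 0 := (Real.sqrt_pos.2 hq0).ne'
  have hs2 := Real.sq_sqrt hq0.le
  field_simp
  linear_combination hs2

theorem trivialParam_mem (q : ℕ) : trivialParam ∈ spectralSet q :=
  .inl (.inl ⟨by simp [trivialParam], by simp [trivialParam]⟩)

theorem signParam_mem (q : ℕ) : signParam q ∈ spectralSet q :=
  .inr ⟨by simp [signParam], by simp [signParam]⟩

theorem adjEigenvalue_trivialParam {q : ℕ} (hq : 2 ≤ q) :
    adjEigenvalue q trivialParam = ((q + 1 : ℝ) : ℂ) := by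
  rw [trivialParam, show Complex.I / 2 = ((1 / 2 : ℝ) : ℂ) * Complex.I by push_cast; ring,
    adjEigenvalue_mul_I, two_mul_sqrt_mul_cosh hq]

theorem adjEigenvalue_signParam {q : ℕ} (hq : 2 ≤ q) :
    adjEigenvalue q (signParam q) = ((-(q + 1) : ℝ) : ℂ) := by
  rw [signParam, show Complex.I / 2 = ((1 / 2 : ℝ) : ℂ) * Complex.I by push_cast; ring,
    adjEigenvalue_halfPeriod_add hq, two_mul_sqrt_mul_cosh hq]

/-- The parameter in `(0, τ/2)` of a tempered eigenvalue `a`, one with `|a| < 2√q`. -/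
noncomputable def temperedParam (q : ℕ) (a : ℝ) : ℂ :=
  ((Real.arccos (a / (2 * √(q : ℝ))) / Real.log q : ℝ) : ℂ)

theorem temperedParam_spec {q : ℕ} (hq : 2 ≤ q) {a : ℝ} (ha : a ^ 2 < 4 * q) :
    temperedParam q a ∈ spectralSet q \ {trivialParam, signParam q} ∧
      adjEigenvalue q (temperedParam q a) = a := by
  have hL : 0 < Real.log q := Real.log_pos (by exact_mod_cast hq)
  have hq0 : (0 : ℝ) < q := by exact_mod_cast (by omega : 0 < q)
  have hs : 0 < √(q : ℝ) := Real.sqrt_pos.2 hq0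
  have hs2 := Real.sq_sqrt hq0.le
  have habs : |a| < 2 * √(q : ℝ) := abs_lt_of_sq_lt_sq (by nlinarith) (by positivity)
  have h1 : -1 < a / (2 * √(q : ℝ)) := by
    rw [lt_div_iff₀ (by positivity)]; linarith [(abs_lt.1 habs).1]
  have h2 : a / (2 * √(q : ℝ)) < 1 := by
    rw [div_lt_iff₀ (by positivity)]; linarith [(abs_lt.1 habs).2]
  refine ⟨⟨.inl (.inr ⟨Complex.ofReal_im _, ?_⟩), ?_⟩, ?_⟩
  · rw [temperedParam, Complex.ofReal_re]
    refine ⟨div_pos (Real.arccos_pos.2 h2) hL, ?_⟩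
    rw [halfPeriod]
    refine div_lt_div_of_pos_right (lt_of_le_of_ne (Real.arccos_le_pi _) fun h => ?_) hL
    rw [Real.arccos_eq_pi] at h
    linarith
  · have him : (temperedParam q a).im = 0 := Complex.ofReal_im _
    rintro (h | h)
    · rw [h] at him; simp [trivialParam] at him
    · rw [Set.mem_singleton_iff.1 h] at him; simp [signParam] at him
  · rw [temperedParam, adjEigenvalue_ofReal, div_mul_cancel₀ _ hL.ne',
      Real.cos_arccos h1.le h2.le]
    congr 1
    field_simp

end SphericalFunctions


/-! ### The covering map and lifts of automorphisms -/

section Covering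

variable {V W : Type*} {X : SimpleGraph W} {u u' : W} {T : SimpleGraph V} {o : V}

/-- `π : T → X` is a covering of graphs whose group of deck transformations `Γ` acts simply
transitively on the fiber `π⁻¹(u)` of the root `o`. -/
structure IsOrbitCovering (X : SimpleGraph W) (u : W) (T : SimpleGraph V) (o : V)
    (Γ : Subgroup (T ≃g T)) (π : V → W) : Prop where
  map_adj : ∀ {x y}, T.Adj x y → X.Adj (π x) (π y)
  existsUnique_lift : ∀ {x w}, X.Adj (π x) w → ∃! y, T.Adj x y ∧ π y = w
  map_deck : ∀ {g}, g ∈ Γ → ∀ x, π (g x) = π x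
  map_root : π o = u
  exists_deck : ∀ {x}, π x = u → ∃ g ∈ Γ, g o = x
  eq_one_of_fixed : ∀ {g}, g ∈ Γ → g o = o → g = 1

theorem CoverVertex.mk_concat_congr {v w : W} {ξ ξ' : X.Walk u v}
    (h : CoverVertex.mk ξ = CoverVertex.mk ξ') (hvw : X.Adj v w) :
    CoverVertex.mk (ξ.concat hvw) = CoverVertex.mk (ξ'.concat hvw) := by
  let f : PathClass X u v → PathClass X u w := Quot.map (fun ξ => ξ.concat hvw) (by
    rintro _ _ ⟨η, h, ζ⟩
    simp only [SimpleGraph.Walk.concat_eq_append, ← SimpleGraph.Walk.append_assoc,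
      SimpleGraph.Walk.cons_append]
    exact PruneStep.prune _ h _)
  exact congrArg (Sigma.mk w) (congrArg f (eq_of_heq (Sigma.mk.inj h).2))

theorem CoverVertex.mk_append_congr {v w : W} {ξ ξ' : X.Walk u v}
    (h : CoverVertex.mk ξ = CoverVertex.mk ξ') (ζ : X.Walk v w) :
    CoverVertex.mk (ξ.append ζ) = CoverVertex.mk (ξ'.append ζ) := by
  induction ζ with
  | nil => simpa using h
  | cons hvw ζ ih =>
    simpa [SimpleGraph.Walk.concat_append] using ih (CoverVertex.mk_concat_congr h hvw)

theorem isOrbitCovering_fst (X : SimpleGraph W) (u : W) (i : coverTree X u ≃g T)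
    (hi : i (coverRoot X u) = o) :
    IsOrbitCovering X u T o (deckGroup X u i) (fun x => (i.symm x).1) where
  map_adj {x y} h := by
    obtain ⟨v, w, η, hvw, h1, h2⟩ := i.symm.map_adj_iff.2 h
    rw [h1, h2]
    exact hvw
  existsUnique_lift {x w} h := by
    obtain ⟨v, ξ, hξ⟩ := (i.symm x).exists_mk
    rw [hξ] at h
    change X.Adj v w at h
    refine ⟨i (CoverVertex.mk (ξ.concat h)), ⟨?_, ?_⟩, ?_⟩
    · rw [← i.symm.map_adj_iff, i.symm_apply_apply, hξ]
      exact ⟨v, w, ξ, h, rfl, rfl⟩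
    · rw [i.symm_apply_apply]; rfl
    · rintro y ⟨hxy, hy⟩
      obtain ⟨v', w', η, hvw, h1, h2⟩ := i.symm.map_adj_iff.2 hxy
      rw [hξ] at h1
      obtain rfl : v = v' := congrArg Sigma.fst h1
      obtain rfl : w' = w := by rw [h2] at hy; exact hy
      rw [CoverVertex.mk_concat_congr h1 h, ← h2, i.apply_symm_apply]
  map_deck := by
    rintro _ ⟨_, ⟨α, rfl⟩, rfl⟩ x
    change (i.symm (i (leftConcatFun α (i.symm x)))).1 = _
    rw [i.symm_apply_apply]
    rfl
  map_root := by
    rw [← hi]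
    rw [i.symm_apply_apply]
    rfl
  exists_deck {x} hx := by
    obtain ⟨v, ξ, hξ⟩ := (i.symm x).exists_mk
    rw [hξ] at hx
    obtain rfl : v = u := hx
    refine ⟨autConj i (leftConcat ξ), ⟨_, ⟨ξ, rfl⟩, rfl⟩, ?_⟩
    change i (leftConcatFun ξ (i.symm o)) = x
    rw [← hi, i.symm_apply_apply, coverRoot, leftConcatFun_mk, SimpleGraph.Walk.append_nil, ← hξ,
      i.apply_symm_apply]
  eq_one_of_fixed := by
    rintro _ ⟨_, ⟨α, rfl⟩, rfl⟩ h
    change i (leftConcatFun α (i.symm o)) = o at h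
    rw [← hi, i.symm_apply_apply, coverRoot, leftConcatFun_mk, SimpleGraph.Walk.append_nil] at h
    ext x
    change i (leftConcatFun α (i.symm x)) = x
    obtain ⟨v, ξ, hξ⟩ := (i.symm x).exists_mk
    rw [hξ, leftConcatFun_mk, CoverVertex.mk_append_congr (i.injective h) ξ,
      SimpleGraph.Walk.nil_append, ← hξ, i.apply_symm_apply]

/-- The lift `[ξ] ↦ [η.β(ξ)]` of an automorphism `β` of `X` to the covering tree. It depends on the
choice of a path `η` from the base point to `β u'`. -/
def liftFun (β : X ≃g X) (η : X.Walk u (β u')) (a : CoverVertex X u') : CoverVertex X u :=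
  ⟨β a.1, Quot.map (fun ξ => η.append (ξ.map β.toHom)) (by
    rintro _ _ ⟨ζ, h, ζ'⟩
    simp only [SimpleGraph.Walk.map_append, SimpleGraph.Walk.map_cons,
      SimpleGraph.Walk.append_assoc]
    exact PruneStep.prune _ _ _) a.2⟩

theorem liftFun_mk (β : X ≃g X) (η : X.Walk u (β u')) {v : W} (ξ : X.Walk u' v) :
    liftFun β η (CoverVertex.mk ξ) = CoverVertex.mk (η.append (ξ.map β.toHom)) := rfl

theorem liftFun_adj (β : X ≃g X) (η : X.Walk u (β u')) {a b : CoverVertex X u'}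
    (hab : (coverTree X u').Adj a b) : (coverTree X u).Adj (liftFun β η a) (liftFun β η b) := by
  obtain ⟨v, w, ξ, h, rfl, rfl⟩ := hab
  refine ⟨β v, β w, η.append (ξ.map β.toHom), β.map_adj_iff.2 h, rfl, ?_⟩
  rw [liftFun_mk, SimpleGraph.Walk.concat_eq_append, SimpleGraph.Walk.map_append,
    SimpleGraph.Walk.append_assoc, SimpleGraph.Walk.concat_eq_append]
  rfl

theorem CoverVertex.mk_append_map_of_eq_id {a v : W} (φ : X →g X) (hφ : φ = SimpleGraph.Hom.id)
    (ζ : X.Walk u (φ a)) (ξ : X.Walk a v) :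
    CoverVertex.mk (ζ.append (ξ.map φ)) =
      CoverVertex.mk ((ζ.copy rfl (by subst hφ; rfl) : X.Walk u a).append ξ) := by
  subst hφ
  rw [SimpleGraph.Walk.map_id]
  rfl

/-- The path that makes the lift of `β⁻¹` inverse to the lift of `β`. -/
def liftInvPath (β : X ≃g X) (η : X.Walk u (β u')) : X.Walk u' (β.symm u) :=
  ((η.map β.symm.toHom).copy rfl (β.symm_apply_apply u')).reverse

theorem liftFun_symm_liftFun (β : X ≃g X) (η : X.Walk u (β u')) (a : CoverVertex X u') :
    liftFun β.symm (liftInvPath β η) (liftFun β η a) = a := by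
  obtain ⟨v, ξ, rfl⟩ := a.exists_mk
  rw [liftFun_mk, liftFun_mk, SimpleGraph.Walk.map_append, SimpleGraph.Walk.append_assoc,
    SimpleGraph.Walk.map_map]
  refine (CoverVertex.mk_append_map_of_eq_id (β.symm.toHom.comp β.toHom)
    (by ext x; exact β.symm_apply_apply x) _ ξ).trans ?_
  have h := CoverVertex.mk_append_reverse (liftInvPath β η) ξ
  conv_rhs => rw [← h]
  congr 2
  rw [liftInvPath, SimpleGraph.Walk.reverse_reverse]
  have : ∀ {a b c c' : W} (p : X.Walk a b) (r : X.Walk b c) (hc : c = c'),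
      (p.append r).copy rfl hc = p.append (r.copy rfl hc) := by
    intro a b c c' p r hc
    subst hc
    rfl
  exact this _ _ _

/-- The lift of an automorphism of `X` to an automorphism of the covering tree. -/
def liftIso (β : X ≃g X) (η : X.Walk u (β u)) : coverTree X u ≃g coverTree X u where
  toFun := liftFun β η
  invFun := liftFun β.symm (liftInvPath β η)
  left_inv := liftFun_symm_liftFun β η
  right_inv a := by
    have h := liftFun_symm_liftFun β.symm (liftInvPath β η)
    -- A left inverse that itself has a left inverse is a two-sided inverse.
    refine Function.LeftInverse.injective h ?_
    exact liftFun_symm_liftFun β η _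
  map_rel_iff' := by
    intro a b
    refine ⟨fun h => ?_, liftFun_adj β η⟩
    have := liftFun_adj β.symm (liftInvPath β η) h
    simpa only [Equiv.coe_fn_mk, liftFun_symm_liftFun] using this

/-- The covering tree of a vertex-transitive graph is vertex-transitive: lift automorphisms that
move the base point to a given vertex. -/
theorem exists_aut_apply_root (i : coverTree X u ≃g T) (hi : i (coverRoot X u) = o)
    (hX : ∀ v, ∃ β : X ≃g X, β u = v) (x : V) : ∃ g : T ≃g T, g o = x := by
  obtain ⟨v, ξ, hξ⟩ := (i.symm x).exists_mk
  obtain ⟨β, rfl⟩ := hX v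
  refine ⟨autConj i (liftIso β ξ), ?_⟩
  change i (liftFun β ξ (i.symm o)) = x
  rw [← hi, i.symm_apply_apply, coverRoot, liftFun_mk, SimpleGraph.Walk.map_nil]
  change i (CoverVertex.mk (ξ.append .nil)) = x
  rw [SimpleGraph.Walk.append_nil, ← hξ, i.apply_symm_apply]

end Covering


/-! ### The random covering -/

section RandomCovering

variable {V W : Type*} {X : SimpleGraph W} {u : W} {T : SimpleGraph V} {o : V}
  {Γ : Subgroup (T ≃g T)} {π : V → W}

/-- The covering `x ↦ π (h⁻¹ x)` of `X` by `T`, which depends only on the coset `hΓ`. For a random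
coset it is a random covering, and the random lattice orbit is its fiber over `u`. -/
def cosetLabel (hπ : IsOrbitCovering X u T o Γ π) (c : (T ≃g T) ⧸ Γ) (x : V) : W :=
  Quotient.liftOn' c (fun h => π (h⁻¹ x)) fun a b hab => by
    have h := hπ.map_deck (QuotientGroup.leftRel_apply.1 hab) (b⁻¹ x)
    rw [← h, RelIso.mul_apply, RelIso.apply_inv_self]

theorem cosetLabel_mk (hπ : IsOrbitCovering X u T o Γ π) (h : T ≃g T) (x : V) :
    cosetLabel hπ (h : (T ≃g T) ⧸ Γ) x = π (h⁻¹ x) := rfl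

theorem cosetLabel_smul (hπ : IsOrbitCovering X u T o Γ π) (g : T ≃g T) (c : (T ≃g T) ⧸ Γ)
    (x : V) : cosetLabel hπ (g • c) (g x) = cosetLabel hπ c x := by
  induction c using QuotientGroup.induction_on with
  | H h =>
    rw [MulAction.Quotient.smul_coe, smul_eq_mul, cosetLabel_mk, cosetLabel_mk, mul_inv_rev,
      RelIso.mul_apply, RelIso.inv_apply_self]

theorem cosetLabel_adj (hπ : IsOrbitCovering X u T o Γ π) (c : (T ≃g T) ⧸ Γ) {x y : V}
    (h : T.Adj x y) : X.Adj (cosetLabel hπ c x) (cosetLabel hπ c y) := by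
  induction c using QuotientGroup.induction_on with
  | H g => exact hπ.map_adj ((g⁻¹).map_adj_iff.2 h)

theorem existsUnique_cosetLabel (hπ : IsOrbitCovering X u T o Γ π) (c : (T ≃g T) ⧸ Γ) {x : V}
    {w : W} (h : X.Adj (cosetLabel hπ c x) w) : ∃! y, T.Adj x y ∧ cosetLabel hπ c y = w := by
  induction c using QuotientGroup.induction_on with
  | H g =>
    obtain ⟨y, ⟨hy, hw⟩, huniq⟩ := hπ.existsUnique_lift h
    refine ⟨g y, ⟨?_, ?_⟩, ?_⟩
    · rw [← (g⁻¹).map_adj_iff, RelIso.inv_apply_self]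
      exact hy
    · rwa [cosetLabel_mk, RelIso.inv_apply_self]
    · rintro z ⟨hz, hzw⟩
      rw [← huniq (g⁻¹ z) ⟨(g⁻¹).map_adj_iff.2 hz, hzw⟩, RelIso.apply_inv_self]

open Classical in
theorem orbitConfig_eq (hπ : IsOrbitCovering X u T o Γ π) (c : (T ≃g T) ⧸ Γ) (x : V) :
    orbitConfig Γ o c x = if cosetLabel hπ c x = u then 1 else 0 := by
  induction c using QuotientGroup.induction_on with
  | H h =>
    rw [cosetLabel_mk, orbitConfig]
    split_ifs with hx
    · obtain ⟨γ, hγ, hγx⟩ := hπ.exists_deck hx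
      have : {g : T ≃g T | (g : (T ≃g T) ⧸ Γ) = h ∧ g o = x} = {h * γ} := by
        ext g
        rw [Set.mem_singleton_iff]
        constructor
        · rintro ⟨hg, hgo⟩
          have hmem : γ⁻¹ * (h⁻¹ * g) ∈ Γ :=
            Γ.mul_mem (Γ.inv_mem hγ) (QuotientGroup.eq.1 hg.symm)
          have h1 := hπ.eq_one_of_fixed hmem (by
            rw [RelIso.mul_apply, RelIso.mul_apply, hgo, ← hγx, RelIso.inv_apply_self])
          rw [inv_mul_eq_one] at h1
          rw [h1, mul_inv_cancel_left]
        · rintro rfl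
          refine ⟨QuotientGroup.mk_mul_of_mem h hγ, ?_⟩
          rw [RelIso.mul_apply, hγx, RelIso.apply_inv_self]
      rw [this, Set.ncard_singleton, Nat.cast_one]
    · have : {g : T ≃g T | (g : (T ≃g T) ⧸ Γ) = h ∧ g o = x} = ∅ := by
        refine Set.eq_empty_iff_forall_notMem.2 ?_
        rintro g ⟨hg, rfl⟩
        refine hx ?_
        rw [← RelIso.mul_apply, hπ.map_deck (QuotientGroup.eq.1 hg.symm), hπ.map_root]
      rw [this, Set.ncard_empty, Nat.cast_zero]

theorem measurableSet_cosetLabel (hπ : IsOrbitCovering X u T o Γ π) (x : V) (w : W) :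
    MeasurableSet {c | cosetLabel hπ c x = w} := by
  rw [measurableSet_quotient]
  have : (Quotient.mk'' ⁻¹' {c | cosetLabel hπ c x = w} : Set (T ≃g T)) =
      ⋃ y ∈ {y | π y = w}, {h : T ≃g T | h y = x} := by
    ext h
    simp only [Set.mem_preimage, Set.mem_ofPred_eq, Set.mem_iUnion, exists_prop]
    constructor
    · intro hh
      exact ⟨h⁻¹ x, hh, RelIso.apply_inv_self _ _⟩
    · rintro ⟨y, hy, rfl⟩
      change π (h⁻¹ (h y)) = w
      rwa [RelIso.inv_apply_self]
  change MeasurableSet (Quotient.mk'' ⁻¹' {c | cosetLabel hπ c x = w} : Set (T ≃g T))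
  rw [this]
  have : BorelSpace (T ≃g T) := ⟨rfl⟩
  refine IsOpen.measurableSet (isOpen_biUnion fun y _ => ?_)
  let _ : TopologicalSpace V := ⊥
  have : DiscreteTopology V := ⟨rfl⟩
  have hc : Continuous fun (g : T ≃g T) => g y :=
    (continuous_apply y).comp (continuous_induced_dom (f := fun (g : T ≃g T) (x : V) => g x))
  exact (isOpen_discrete {x}).preimage hc

theorem measurable_orbitConfig (hπ : IsOrbitCovering X u T o Γ π) :
    Measurable (orbitConfig Γ o) := by
  classical
  refine measurable_pi_iff.2 fun x => ?_
  simp only [orbitConfig_eq hπ]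
  exact Measurable.ite (measurableSet_cosetLabel hπ x u) measurable_const measurable_const

variable (m : Measure ((T ≃g T) ⧸ Γ))

theorem measureReal_cosetLabel_eq [SMulInvariantMeasure (T ≃g T) ((T ≃g T) ⧸ Γ) m]
    (hπ : IsOrbitCovering X u T o Γ π) (htrans : ∀ x, ∃ g : T ≃g T, g o = x) (x : V) (w : W) :
    m.real {c | cosetLabel hπ c x = w} = m.real {c | cosetLabel hπ c o = w} := by
  obtain ⟨g, rfl⟩ := htrans x
  have := SMulInvariantMeasure.measure_preimage_smul (μ := m) g
    (measurableSet_cosetLabel hπ (g o) w)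
  simp only [Set.preimage_ofPred_eq, cosetLabel_smul] at this
  rw [measureReal_def, measureReal_def, this]

theorem integrable_comp_cosetLabel [Finite W] [IsProbabilityMeasure m] {E : Type*}
    [NormedAddCommGroup E]
    (hπ : IsOrbitCovering X u T o Γ π) (x : V) (F : W → E) :
    Integrable (fun c => F (cosetLabel hπ c x)) m := by
  classical
  have := Fintype.ofFinite W
  have h : (fun c => F (cosetLabel hπ c x)) = fun c =>
      ∑ w, {c | cosetLabel hπ c x = w}.indicator (fun _ => F w) c := by
    ext c
    simp [Set.indicator_apply]
  rw [h]
  exact integrable_finsetSum _ fun w _ =>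
    (integrable_const _).indicator (measurableSet_cosetLabel hπ x w)

theorem integral_comp_cosetLabel [Fintype W] [IsProbabilityMeasure m] {E : Type*}
    [NormedAddCommGroup E] [NormedSpace ℝ E] [CompleteSpace E]
    (hπ : IsOrbitCovering X u T o Γ π) (x : V) (F : W → E) :
    ∫ c, F (cosetLabel hπ c x) ∂m = ∑ w, m.real {c | cosetLabel hπ c x = w} • F w := by
  classical
  have h : (fun c => F (cosetLabel hπ c x)) = fun c =>
      ∑ w, {c | cosetLabel hπ c x = w}.indicator (fun _ => F w) c := by
    ext c
    simp [Set.indicator_apply]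
  rw [h, integral_finsetSum]
  · refine Finset.sum_congr rfl fun w _ => ?_
    rw [integral_indicator_const _ (measurableSet_cosetLabel hπ x w)]
  · exact fun w _ => (integrable_const _).indicator (measurableSet_cosetLabel hπ x w)

/-- A function on `X`, pulled back by a covering, has neighbor sums pulled back from `X`. -/
theorem sum_neighbors_cosetLabel [Fintype W] [DecidableRel X.Adj] [T.LocallyFinite]
    {R : Type*} [AddCommMonoid R]
    (hπ : IsOrbitCovering X u T o Γ π) (c : (T ≃g T) ⧸ Γ) (x : V) (F : W → R) :
    ∑ y ∈ T.neighborFinset x, F (cosetLabel hπ c y) =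
      ∑ w ∈ X.neighborFinset (cosetLabel hπ c x), F w := by
  refine Finset.sum_bij (fun y _ => cosetLabel hπ c y) ?_ ?_ ?_ fun _ _ => rfl
  · intro y hy
    rw [SimpleGraph.mem_neighborFinset] at hy ⊢
    exact cosetLabel_adj hπ c hy
  · intro y hy y' hy' h
    rw [SimpleGraph.mem_neighborFinset] at hy hy'
    exact (existsUnique_cosetLabel hπ c (cosetLabel_adj hπ c hy')).unique ⟨hy, h⟩ ⟨hy', rfl⟩
  · intro w hw
    rw [SimpleGraph.mem_neighborFinset] at hw
    obtain ⟨y, ⟨hy, hyw⟩, -⟩ := existsUnique_cosetLabel hπ c hw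
    exact ⟨y, (T.mem_neighborFinset x y).2 hy, hyw⟩

/-- The label of the root is uniformly distributed. By invariance its law is the law of the label
of each neighbor, hence a stationary measure of the simple random walk on `X`. -/
theorem measureReal_cosetLabel [Fintype W] [DecidableRel X.Adj] [T.LocallyFinite] {q : ℕ}
    [IsProbabilityMeasure m] [SMulInvariantMeasure (T ≃g T) ((T ≃g T) ⧸ Γ) m]
    (hπ : IsOrbitCovering X u T o Γ π) (htrans : ∀ x, ∃ g : T ≃g T, g o = x)
    (hX : X.Connected) (hXreg : X.IsRegularOfDegree (q + 1))
    (hreg : T.IsRegularOfDegree (q + 1)) (w : W) :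
    m.real {c | cosetLabel hπ c o = w} = 1 / Fintype.card W := by
  classical
  set ν : W → ℝ := fun w => m.real {c | cosetLabel hπ c o = w} with hν
  have hstat : ∀ w, ∑ w' ∈ X.neighborFinset w, ν w' = (q + 1) * ν w := by
    intro w
    have h1 : ∀ c, ∑ y ∈ T.neighborFinset o, (if cosetLabel hπ c y = w then (1 : ℝ) else 0) =
        if cosetLabel hπ c o ∈ X.neighborFinset w then 1 else 0 := fun c => by
      rw [sum_neighbors_cosetLabel hπ c o (fun w' => if w' = w then (1 : ℝ) else 0),
        Finset.sum_ite_eq']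
      simp only [SimpleGraph.mem_neighborFinset, X.adj_comm]
    have h2 := congrArg (fun F => ∫ c, F c ∂m) (funext h1)
    simp only at h2
    rw [integral_finsetSum _ fun y _ => integrable_comp_cosetLabel m hπ y
        (fun w' => if w' = w then (1 : ℝ) else 0),
      integral_comp_cosetLabel m hπ o (fun w' => if w' ∈ X.neighborFinset w then (1 : ℝ) else 0)]
      at h2
    simp only [integral_comp_cosetLabel m hπ _ (fun w' => if w' = w then (1 : ℝ) else 0),
      measureReal_cosetLabel_eq m hπ htrans, smul_eq_mul, mul_ite, mul_one, mul_zero,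
      Finset.sum_ite_eq', Finset.mem_univ, if_true, Finset.sum_const,
      SimpleGraph.card_neighborFinset_eq_degree, hreg.degree_eq, Finset.sum_ite_mem,
      Finset.univ_inter, nsmul_eq_mul] at h2
    rw [hν, ← h2]
    push_cast
    ring
  have hlap : (X.lapMatrix ℝ).mulVec ν = 0 := by
    ext w
    rw [SimpleGraph.lapMatrix_mulVec_apply, hstat, hXreg.degree_eq, Pi.zero_apply]
    push_cast
    ring
  have hconst := X.lapMatrix_mulVec_eq_zero_iff_forall_reachable.1 hlap
  have hsum : ∑ w, ν w = 1 := by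
    have := integral_comp_cosetLabel m hπ o (fun _ => (1 : ℝ))
    simpa using this.symm
  rw [Finset.sum_congr rfl fun w' _ => hconst w' w (hX w' w), Finset.sum_const, Finset.card_univ,
    nsmul_eq_mul] at hsum
  exact eq_one_div_of_mul_eq_one_right hsum

end RandomCovering


/-! ### The Hecke algebra as a polynomial algebra -/

section Hecke

variable {V : Type*} {T : SimpleGraph V} {o : V}

/-- `f` is an element of the Hecke algebra, and convolution with `f` is the polynomial `p` in the
adjacency operator, in the sense that pairing `f` with an eigenfunction `g` of eigenvalue `a`
gives `p(a) g(o)`. -/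
structure HasHeckePoly (T : SimpleGraph V) [T.LocallyFinite] (o : V) (f : V → ℂ)
    (p : Polynomial ℂ) : Prop where
  isHecke : IsHecke T o f
  finsum_mul : ∀ (a : ℂ) (g : V → ℂ), (∀ x, ∑ y ∈ T.neighborFinset x, g y = a * g x) →
    ∑ᶠ x, f x * g x = p.eval a * g o

theorem finite_support_mul {f : V → ℂ} (hf : f.support.Finite) (g : V → ℂ) :
    (Function.support fun x => f x * g x).Finite :=
  hf.subset fun x hx => fun h => hx (by simp [h])

theorem HasHeckePoly.congr [T.LocallyFinite] {f f' : V → ℂ} {p p' : Polynomial ℂ}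
    (h : HasHeckePoly T o f p) (hf : f' = f) (hp : p' = p) : HasHeckePoly T o f' p' := by
  rwa [hf, hp]

theorem HasHeckePoly.zero [T.LocallyFinite] : HasHeckePoly T o 0 0 :=
  ⟨⟨by simp, fun _ _ _ => rfl⟩, by simp⟩

theorem HasHeckePoly.add [T.LocallyFinite] {f₁ f₂ : V → ℂ} {p₁ p₂ : Polynomial ℂ}
    (h₁ : HasHeckePoly T o f₁ p₁) (h₂ : HasHeckePoly T o f₂ p₂) :
    HasHeckePoly T o (f₁ + f₂) (p₁ + p₂) where
  isHecke := ⟨(h₁.1.1.union h₂.1.1).subset (Function.support_add _ _), fun x y h => by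
    rw [Pi.add_apply, Pi.add_apply, h₁.1.2 x y h, h₂.1.2 x y h]⟩
  finsum_mul a g hg := by
    simp only [Pi.add_apply, add_mul, Polynomial.eval_add]
    rw [finsum_add_distrib (finite_support_mul h₁.1.1 g) (finite_support_mul h₂.1.1 g),
      h₁.2 a g hg, h₂.2 a g hg]

theorem HasHeckePoly.smul [T.LocallyFinite] {f : V → ℂ} {p : Polynomial ℂ} (b : ℂ)
    (h : HasHeckePoly T o f p) : HasHeckePoly T o (b • f) (b • p) where
  isHecke := ⟨h.1.1.subset (Function.support_const_smul_subset b f), fun x y hxy => by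
    rw [Pi.smul_apply, Pi.smul_apply, h.1.2 x y hxy]⟩
  finsum_mul a g hg := by
    simp only [Pi.smul_apply, smul_eq_mul, mul_assoc, Polynomial.eval_smul]
    rw [← mul_finsum, h.2 a g hg]

theorem HasHeckePoly.sum [T.LocallyFinite] {ι : Type*} (s : Finset ι) {f : ι → V → ℂ}
    {p : ι → Polynomial ℂ} (h : ∀ i, HasHeckePoly T o (f i) (p i)) :
    HasHeckePoly T o (∑ i ∈ s, f i) (∑ i ∈ s, p i) := by
  classical
  induction s using Finset.induction_on with
  | empty => simpa using HasHeckePoly.zero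
  | insert i s hi ih =>
    rw [Finset.sum_insert hi, Finset.sum_insert hi]
    exact (h i).add ih

open Classical in
theorem hasHeckePoly_sphere [T.LocallyFinite] {q : ℕ} (hT : T.IsTree)
    (hreg : T.IsRegularOfDegree (q + 1)) (n : ℕ) :
    HasHeckePoly T o (fun x => if T.dist o x = n then 1 else 0)
      (spherePoly q Polynomial.X n) where
  isHecke := ⟨(sphere T o n).finite_toSet.subset fun x hx => by
      by_contra h
      rw [Finset.mem_coe, mem_sphere hT.connected] at h
      exact hx (if_neg h), fun x y h => by simp only [h]⟩
  finsum_mul a g hg := by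
    have h := map_spherePoly (Polynomial.evalRingHom a) q Polynomial.X n
    simp only [Polynomial.coe_evalRingHom, Polynomial.eval_X] at h
    rw [h, ← sum_sphere_eigenfunction hT hreg hg, finsum_eq_sum_of_support_subset (s := sphere T o n)]
    · refine Finset.sum_congr rfl fun x hx => ?_
      rw [if_pos ((mem_sphere hT.connected).1 hx), one_mul]
    · intro x hx
      by_contra h
      rw [Finset.mem_coe, mem_sphere hT.connected] at h
      exact hx (by simp [h])

theorem hasHeckePoly_ball [T.LocallyFinite] {q : ℕ} (hT : T.IsTree)
    (hreg : T.IsRegularOfDegree (q + 1)) (r : ℕ) :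
    HasHeckePoly T o ((ball T o r).indicator 1) (ballPoly q Polynomial.X r) := by
  classical
  have h := HasHeckePoly.sum (Finset.range (r + 1)) (hasHeckePoly_sphere (o := o) hT hreg)
  have hf : (ball T o r).indicator 1 =
      ∑ n ∈ Finset.range (r + 1), fun x => if T.dist o x = n then (1 : ℂ) else 0 := by
    ext x
    rw [Finset.sum_apply, Finset.sum_ite_eq, Set.indicator_apply]
    refine if_congr ?_ rfl rfl
    rw [Finset.mem_range, Nat.lt_succ_iff]
    rfl
  rw [hf]
  exact h

theorem IsHecke.exists_poly [T.LocallyFinite] {q : ℕ} (hT : T.IsTree)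
    (hreg : T.IsRegularOfDegree (q + 1)) {f : V → ℂ} (hf : IsHecke T o f) :
    ∃ p, HasHeckePoly T o f p := by
  classical
  obtain ⟨a, ha⟩ : ∃ a : ℕ → ℂ, ∀ x, f x = a (T.dist o x) :=
    ⟨Function.extend (T.dist o) f 0, fun x =>
      (Function.FactorsThrough.extend_apply (fun x y h => hf.2 x y h) 0 x).symm⟩
  obtain ⟨N, hN⟩ := (hf.1.image (T.dist o)).bddAbove
  have h := HasHeckePoly.sum (Finset.range (N + 1)) fun n =>
    (hasHeckePoly_sphere (o := o) hT hreg n).smul (a n)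
  refine ⟨_, h.congr ?_ rfl⟩
  ext x
  simp only [Finset.sum_apply, Pi.smul_apply, smul_eq_mul, mul_ite, mul_one, mul_zero]
  rw [Finset.sum_ite_eq, ha]
  split_ifs with hx
  · rfl
  · by_contra hne
    rw [← ha] at hne
    exact hx (Finset.mem_range.2 (Nat.lt_succ_of_le (hN ⟨x, hne, rfl⟩)))

theorem exists_hasHeckePoly [T.LocallyFinite] {q : ℕ} (hT : T.IsTree)
    (hreg : T.IsRegularOfDegree (q + 1)) (p : Polynomial ℂ) : ∃ f, HasHeckePoly T o f p := by
  classical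
  have hX : ∀ n m, ∃ f, HasHeckePoly T o f (Polynomial.X ^ n * spherePoly q Polynomial.X m) := by
    intro n
    induction n with
    | zero => exact fun m => ⟨_, by simpa using hasHeckePoly_sphere hT hreg m⟩
    | succ n ih =>
      intro m
      match m with
      | 0 =>
        obtain ⟨f, hf⟩ := ih 1
        refine ⟨f, hf.congr rfl ?_⟩
        simp only [spherePoly]
        ring
      | 1 =>
        obtain ⟨f, hf⟩ := ih 2
        obtain ⟨f', hf'⟩ := ih 0
        refine ⟨_, (hf.add (hf'.smul (q + 1))).congr rfl ?_⟩
        simp only [spherePoly, Polynomial.smul_eq_C_mul, map_add, map_natCast, map_one]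
        ring
      | m + 2 =>
        obtain ⟨f, hf⟩ := ih (m + 3)
        obtain ⟨f', hf'⟩ := ih (m + 1)
        refine ⟨_, (hf.add (hf'.smul q)).congr rfl ?_⟩
        rw [spherePoly.eq_4]
        simp only [Polynomial.smul_eq_C_mul, map_natCast]
        ring
  induction p using Polynomial.induction_on' with
  | add p₁ p₂ h₁ h₂ =>
    obtain ⟨f₁, h₁⟩ := h₁
    obtain ⟨f₂, h₂⟩ := h₂
    exact ⟨_, h₁.add h₂⟩
  | monomial n b =>
    obtain ⟨f, hf⟩ := hX n 0
    refine ⟨_, (hf.smul b).congr rfl ?_⟩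
    simp [spherePoly, Polynomial.smul_eq_C_mul, Polynomial.C_mul_X_pow_eq_monomial]

theorem HasHeckePoly.sphericalTransform_eq [T.LocallyFinite] {q : ℕ} (hq : 2 ≤ q) (hT : T.IsTree)
    (hreg : T.IsRegularOfDegree (q + 1)) {f : V → ℂ} {p : Polynomial ℂ} (h : HasHeckePoly T o f p)
    (z : ℂ) : sphericalTransform T o q f z = p.eval (adjEigenvalue q z) := by
  rw [sphericalTransform, h.2 _ _ (sum_neighbors_sphericalFun hq hT hreg z), SimpleGraph.dist_self,
    sphericalFun_zero hq, mul_one]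

theorem finsum_mem_ball {M : Type*} [AddCommMonoid M] [T.LocallyFinite] (hT : T.IsTree) (r : ℕ)
    (g : V → M) :
    ∑ᶠ x ∈ ball T o r, g x = ∑ n ∈ Finset.range (r + 1), ∑ x ∈ sphere T o n, g x := by
  classical
  rw [← Finset.sum_biUnion, ← finsum_mem_coe_finset]
  · refine finsum_mem_congr (Set.ext fun x => ?_) fun _ _ => rfl
    simp [ball, mem_sphere hT.connected]
  · intro m _ n _ hmn
    refine Finset.disjoint_left.2 fun x hx hx' => hmn ?_
    rw [mem_sphere hT.connected] at hx hx'
    exact hx.symm.trans hx'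

theorem finite_ball [T.LocallyFinite] (hT : T.IsTree) (r : ℕ) : (ball T o r).Finite := by
  classical
  refine ((Finset.range (r + 1)).biUnion (sphere T o)).finite_toSet.subset fun x hx => ?_
  simpa [mem_sphere hT.connected] using show T.dist o x ≤ r from hx

theorem ncard_ball [T.LocallyFinite] {q : ℕ} (hT : T.IsTree) (hreg : T.IsRegularOfDegree (q + 1))
    (r : ℕ) : ((ball T o r).ncard : ℝ) = ballPoly q (q + 1 : ℝ) r := by
  have h : (ball T o r).ncard = ∑ᶠ x ∈ ball T o r, 1 := by
    rw [Set.ncard_eq_toFinset_card _ (finite_ball hT r),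
      finsum_mem_eq_finite_toFinset_sum _ (finite_ball hT r), Finset.card_eq_sum_ones]
  rw [h, finsum_mem_ball hT]
  simp [ballPoly, card_sphere hT hreg]

end Hecke


/-! ### The diffraction measure of a fundamental group orbit -/

section Diffraction

variable {V W ι : Type*} {X : SimpleGraph W} {u : W} {T : SimpleGraph V} {o : V}

/-- The decomposition of the point mass at the vertex `u` of a finite graph into eigenfunctions
`F j` of the adjacency operator, with distinct eigenvalues `a j`. -/
structure IsSpectralDecomposition [Fintype ι] [X.LocallyFinite] (u : W) (a : ι → ℝ)
    (F : ι → W → ℝ) : Prop where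
  injective : Function.Injective a
  sum_neighbors : ∀ j w, ∑ w' ∈ X.neighborFinset w, F j w' = a j * F j w
  sum_eq_one : ∑ j, F j u = 1
  sum_eq_zero : ∀ w, w ≠ u → ∑ j, F j w = 0

/-- Eigenfunctions for different eigenvalues are orthogonal, so that `‖F j‖² = ⟨F j, δ_u⟩`. -/
theorem IsSpectralDecomposition.sum_mul [Fintype ι] [DecidableEq ι] [Fintype W]
    [DecidableRel X.Adj] {a : ι → ℝ} {F : ι → W → ℝ}
    (hF : IsSpectralDecomposition (X := X) u a F) (j k : ι) :
    ∑ w, F j w * F k w = if j = k then F j u else 0 := by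
  classical
  have horth : ∀ j k, j ≠ k → ∑ w, F j w * F k w = 0 := by
    intro j k hjk
    have h : a j * ∑ w, F j w * F k w = a k * ∑ w, F j w * F k w := by
      simp only [Finset.mul_sum]
      calc ∑ w, a j * (F j w * F k w)
          = ∑ w, ∑ w', if X.Adj w w' then F j w' * F k w else 0 := by
            refine Finset.sum_congr rfl fun w _ => ?_
            rw [← mul_assoc, ← hF.sum_neighbors, Finset.sum_mul, ← Finset.sum_filter]
            refine Finset.sum_congr ?_ fun _ _ => rfl
            ext; simp
        _ = ∑ w, ∑ w', if X.Adj w w' then F j w * F k w' else 0 := by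
            rw [Finset.sum_comm]
            simp only [X.adj_comm]
        _ = ∑ w, a k * (F j w * F k w) := by
            refine Finset.sum_congr rfl fun w _ => ?_
            rw [mul_left_comm, ← hF.sum_neighbors, Finset.mul_sum, ← Finset.sum_filter]
            refine Finset.sum_congr ?_ fun _ _ => rfl
            ext; simp
    by_contra h0
    exact hjk (hF.injective (mul_right_cancel₀ h0 h))
  split_ifs with hjk
  · subst hjk
    have h : ∑ w, F j w * ∑ k, F k w = F j u := by
      rw [Finset.sum_eq_single u, hF.sum_eq_one, mul_one]
      · intro w _ hw
        rw [hF.sum_eq_zero w hw, mul_zero]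
      · simp
    rw [← h]
    simp only [Finset.mul_sum]
    rw [Finset.sum_comm, Finset.sum_eq_single j]
    · intro k _ hk
      exact horth j k hk.symm
    · simp
  · exact horth j k hjk

theorem IsSpectralDecomposition.nonneg [Fintype ι] [Fintype W]
    [DecidableRel X.Adj] {a : ι → ℝ} {F : ι → W → ℝ}
    (hF : IsSpectralDecomposition (X := X) u a F) (j : ι) : 0 ≤ F j u := by
  classical
  have h := hF.sum_mul j j
  rw [if_pos rfl] at h
  rw [← h]
  exact Finset.sum_nonneg fun w _ => mul_self_nonneg _

theorem linearStatistic_orbitConfig [Fintype ι] [Fintype W] [DecidableRel X.Adj]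
    [T.LocallyFinite] {Γ : Subgroup (T ≃g T)} {π : V → W} {a : ι → ℝ} {F : ι → W → ℝ}
    (hF : IsSpectralDecomposition (X := X) u a F) (hπ : IsOrbitCovering X u T o Γ π) {f : V → ℂ}
    {p : Polynomial ℂ} (hf : HasHeckePoly T o f p) (c : (T ≃g T) ⧸ Γ) :
    linearStatistic f (orbitConfig Γ o c) =
      ∑ j, p.eval (a j : ℂ) * (F j (cosetLabel hπ c o) : ℂ) := by
  classical
  have h1 : ∀ x, ((orbitConfig Γ o c x : ℝ) : ℂ) = ∑ j, (F j (cosetLabel hπ c x) : ℂ) := by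
    intro x
    rw [orbitConfig_eq hπ]
    split_ifs with hx
    · rw [hx, ← Complex.ofReal_sum, hF.sum_eq_one]; simp
    · rw [← Complex.ofReal_sum, hF.sum_eq_zero _ hx]; simp
  rw [linearStatistic]
  simp only [h1, Finset.sum_mul]
  rw [finsum_sum_comm]
  · refine Finset.sum_congr rfl fun j _ => ?_
    rw [← hf.2 (a j) (fun x => (F j (cosetLabel hπ c x) : ℂ))]
    · exact finsum_congr fun x => mul_comm _ _
    · intro x
      rw [sum_neighbors_cosetLabel hπ c x (fun w => (F j w : ℂ)), ← Complex.ofReal_sum,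
        hF.sum_neighbors, Complex.ofReal_mul]
  · intro j _
    refine (finite_support_mul hf.1.1 fun x => (F j (cosetLabel hπ c x) : ℂ)).subset fun x hx => ?_
    simpa [mul_comm] using hx

theorem measurable_linearStatistic {f : V → ℂ} (hf : f.support.Finite) :
    Measurable (linearStatistic f) := by
  have h : linearStatistic f = fun p : Config V => ∑ x ∈ hf.toFinset, ((p x : ℝ) : ℂ) * f x := by
    ext p
    refine finsum_eq_sum_of_support_subset _ fun x hx => ?_
    simp only [Set.Finite.coe_toFinset, Function.mem_support]
    exact fun h => hx (by simp [h])
  rw [h]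
  fun_prop

theorem degree_eq_of_ncard [T.LocallyFinite] {d : ℕ} (hreg : ∀ x, (T.neighborSet x).ncard = d) :
    T.IsRegularOfDegree d := fun x => by
  rw [← hreg x, ← SimpleGraph.coe_neighborFinset, Set.ncard_coe_finset,
    SimpleGraph.card_neighborFinset_eq_degree]

/-- The correlations of linear statistics. By uniformity of the label of the root and orthogonality
only the diagonal terms of the spectral decomposition survive. -/
theorem integral_linearStatistic [Fintype ι] [Fintype W] [DecidableRel X.Adj] [T.LocallyFinite]
    {q : ℕ} {a : ι → ℝ} {F : ι → W → ℝ}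
    (hF : IsSpectralDecomposition (X := X) u a F) (hX : X.Connected)
    (hXreg : X.IsRegularOfDegree (q + 1)) (hXtrans : ∀ v, ∃ β : X ≃g X, β u = v)
    (hreg : T.IsRegularOfDegree (q + 1)) {μ : Measure (Config V)}
    (hμ : IsFundamentalGroupOrbit X u T o μ) {f₁ f₂ : V → ℂ} {p₁ p₂ : Polynomial ℂ}
    (h₁ : HasHeckePoly T o f₁ p₁) (h₂ : HasHeckePoly T o f₂ p₂) :
    ∫ c, linearStatistic f₁ c * (starRingEnd ℂ) (linearStatistic f₂ c) ∂μ =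
      ∑ j, (F j u / Fintype.card W : ℝ) *
        (p₁.eval (a j : ℂ) * (starRingEnd ℂ) (p₂.eval (a j : ℂ))) := by
  classical
  obtain ⟨i, hi, m, hm, hinv, rfl⟩ := hμ
  have hπ := isOrbitCovering_fst X u i hi
  rw [integral_map (measurable_orbitConfig hπ).aemeasurable]
  · simp only [linearStatistic_orbitConfig hF hπ h₁, linearStatistic_orbitConfig hF hπ h₂]
    rw [integral_comp_cosetLabel m hπ o (fun w => (∑ j, p₁.eval (a j : ℂ) * (F j w : ℂ)) *
      (starRingEnd ℂ) (∑ j, p₂.eval (a j : ℂ) * (F j w : ℂ)))]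
    simp only [measureReal_cosetLabel m hπ (exists_aut_apply_root i hi hXtrans) hX hXreg hreg]
    rw [← Finset.smul_sum]
    have h : ∑ w, (∑ j, p₁.eval (a j : ℂ) * (F j w : ℂ)) *
        (starRingEnd ℂ) (∑ j, p₂.eval (a j : ℂ) * (F j w : ℂ)) =
        ∑ j, ∑ k, p₁.eval (a j : ℂ) * (starRingEnd ℂ) (p₂.eval (a k : ℂ)) *
          ((∑ w, F j w * F k w : ℝ) : ℂ) := by
      simp only [map_sum, map_mul, Complex.conj_ofReal, Finset.sum_mul_sum]
      rw [Finset.sum_comm]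
      refine Finset.sum_congr rfl fun j _ => ?_
      rw [Finset.sum_comm]
      refine Finset.sum_congr rfl fun k _ => ?_
      push_cast
      rw [Finset.mul_sum]
      exact Finset.sum_congr rfl fun w _ => by ring
    rw [h]
    simp only [hF.sum_mul]
    rw [Finset.smul_sum]
    refine Finset.sum_congr rfl fun j _ => ?_
    rw [Finset.sum_eq_single j]
    · rw [if_pos rfl, Complex.real_smul]
      push_cast
      ring
    · intro k _ hk
      rw [if_neg hk.symm]
      simp
    · simp
  · have m1 := measurable_linearStatistic h₁.1.1
    have m2 := measurable_linearStatistic h₂.1.1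
    exact (m1.mul (Complex.continuous_conj.measurable.comp m2)).aestronglyMeasurable

/-- The measure with mass `c j` at the point `z j`. -/
noncomputable def atomicMeasure [Fintype ι] (c : ι → ℝ) (z : ι → ℂ) : Measure ℂ :=
  ∑ j, ENNReal.ofReal (c j) • Measure.dirac (z j)

theorem integral_atomicMeasure [Fintype ι] {c : ι → ℝ} (hc : ∀ j, 0 ≤ c j) (z : ι → ℂ)
    {E : Type*} [NormedAddCommGroup E] [NormedSpace ℝ E] [CompleteSpace E] (g : ℂ → E) :
    ∫ w, g w ∂(atomicMeasure c z) = ∑ j, c j • g (z j) := by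
  have hint : ∀ j, Integrable g (ENNReal.ofReal (c j) • Measure.dirac (z j)) := fun j =>
    (integrable_dirac (by simp)).smul_measure ENNReal.ofReal_ne_top
  rw [atomicMeasure, integral_finsetSum_measure fun j _ => hint j]
  refine Finset.sum_congr rfl fun j _ => ?_
  rw [integral_smul_measure, integral_dirac, ENNReal.toReal_ofReal (hc j)]

instance [Fintype ι] (c : ι → ℝ) (z : ι → ℂ) : IsFiniteMeasure (atomicMeasure c z) := by
  refine ⟨?_⟩
  rw [atomicMeasure, Measure.finsetSum_apply]
  simp

theorem isDiffractionMeasure_atomicMeasure [Fintype ι] [T.LocallyFinite] {q : ℕ} (hq : 2 ≤ q)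
    (hT : T.IsTree) (hreg : T.IsRegularOfDegree (q + 1)) {a c : ι → ℝ} {z : ι → ℂ}
    (hc : ∀ j, 0 ≤ c j) (hz : ∀ j, z j ∈ spectralSet q) (hza : ∀ j, adjEigenvalue q (z j) = a j)
    {μ : Measure (Config V)}
    (hμ : ∀ f₁ f₂ p₁ p₂, HasHeckePoly T o f₁ p₁ → HasHeckePoly T o f₂ p₂ →
      ∫ c, linearStatistic f₁ c * (starRingEnd ℂ) (linearStatistic f₂ c) ∂μ =
        ∑ j, c j * (p₁.eval (a j : ℂ) * (starRingEnd ℂ) (p₂.eval (a j : ℂ)))) :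
    IsDiffractionMeasure T o q μ (atomicMeasure c z) where
  finite := inferInstance
  carrier := by
    rw [atomicMeasure, Measure.finsetSum_apply]
    refine Finset.sum_eq_zero fun j _ => ?_
    rw [Measure.smul_apply, Measure.dirac_apply' _ (measurableSet_spectralSet q).compl]
    simp [hz j]
  inner_eq f₁ f₂ h₁ h₂ := by
    obtain ⟨p₁, h₁⟩ := h₁.exists_poly hT hreg
    obtain ⟨p₂, h₂⟩ := h₂.exists_poly hT hreg
    rw [hμ f₁ f₂ p₁ p₂ h₁ h₂, integral_atomicMeasure hc]
    simp only [h₁.sphericalTransform_eq hq hT hreg, h₂.sphericalTransform_eq hq hT hreg, hza,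
      Complex.real_smul]

theorem integrable_of_continuous {q : ℕ} (hq : 2 ≤ q) {σ : Measure ℂ} [IsFiniteMeasure σ]
    (hσ : σ (spectralSet q)ᶜ = 0) {E : Type*} [NormedAddCommGroup E] {g : ℂ → E}
    (hg : Continuous g) : Integrable g σ := by
  have h : IntegrableOn g (Metric.closedBall 0 (halfPeriod q + 1 / 2)) σ :=
    hg.continuousOn.integrableOn_compact (isCompact_closedBall _ _)
  rwa [IntegrableOn, Measure.restrict_eq_self_of_ae_mem] at h
  rw [← compl_compl (spectralSet q)] at *
  exact measure_mono_null (Set.compl_subset_compl.2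
    (by rw [compl_compl]; exact spectralSet_subset_closedBall hq)) hσ

/-- A diffraction measure with finitely many spectral parameters in its correlation formula is
carried by these parameters, since it annihilates the polynomial `∏ (x - a j)`, and its masses are
determined by the Lagrange interpolation polynomials. -/
theorem IsDiffractionMeasure.eq_atomicMeasure [Fintype ι] [T.LocallyFinite] {q : ℕ} (hq : 2 ≤ q)
    (hT : T.IsTree) (hreg : T.IsRegularOfDegree (q + 1)) {a c : ι → ℝ} {z : ι → ℂ}
    (hc : ∀ j, 0 ≤ c j) (ha : Function.Injective a)
    (hz : ∀ j, z j ∈ spectralSet q) (hza : ∀ j, adjEigenvalue q (z j) = a j)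
    {μ : Measure (Config V)}
    (hμ : ∀ f₁ f₂ p₁ p₂, HasHeckePoly T o f₁ p₁ → HasHeckePoly T o f₂ p₂ →
      ∫ c, linearStatistic f₁ c * (starRingEnd ℂ) (linearStatistic f₂ c) ∂μ =
        ∑ j, c j * (p₁.eval (a j : ℂ) * (starRingEnd ℂ) (p₂.eval (a j : ℂ))))
    {σ : Measure ℂ} (hσ : IsDiffractionMeasure T o q μ σ) : σ = atomicMeasure c z := by
  classical
  have := hσ.finite
  have hσ₀ := isDiffractionMeasure_atomicMeasure (o := o) hq hT hreg hc hz hza hμ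
  have hzinj : Function.Injective z := fun j k h => ha (by
    have := hza j
    rw [h, hza k] at this
    exact_mod_cast this.symm)
  -- Both measures integrate products of polynomials in the eigenvalue in the same way.
  have hpoly : ∀ p₁ p₂ : Polynomial ℂ,
      ∫ w, p₁.eval (adjEigenvalue q w) * (starRingEnd ℂ) (p₂.eval (adjEigenvalue q w)) ∂σ =
      ∑ j, c j • (p₁.eval (a j : ℂ) * (starRingEnd ℂ) (p₂.eval (a j : ℂ))) := by
    intro p₁ p₂
    obtain ⟨f₁, h₁⟩ := exists_hasHeckePoly (o := o) hT hreg p₁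
    obtain ⟨f₂, h₂⟩ := exists_hasHeckePoly (o := o) hT hreg p₂
    have h := (hσ.inner_eq f₁ f₂ h₁.1 h₂.1).symm.trans (hσ₀.inner_eq f₁ f₂ h₁.1 h₂.1)
    rw [integral_atomicMeasure hc] at h
    simpa only [h₁.sphericalTransform_eq hq hT hreg, h₂.sphericalTransform_eq hq hT hreg, hza]
      using h
  have hcont : ∀ p : Polynomial ℂ, Continuous fun w => p.eval (adjEigenvalue q w) := fun p =>
    p.continuous.comp (continuous_adjEigenvalue q)
  set S : Finset ℂ := Finset.univ.image z with hS
  have hsupp : σ (S : Set ℂ)ᶜ = 0 := by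
    set Q : Polynomial ℂ := ∏ j, (Polynomial.X - Polynomial.C (a j : ℂ)) with hQ
    have hQ0 : ∀ x : ℂ, Q.eval x = 0 ↔ ∃ j, x = a j := fun x => by
      rw [hQ, Polynomial.eval_prod, Finset.prod_eq_zero_iff]
      simp [sub_eq_zero]
    have h := hpoly Q Q
    rw [Finset.sum_eq_zero fun j _ => by rw [(hQ0 _).2 ⟨j, rfl⟩, zero_mul, smul_zero]] at h
    simp only [Complex.mul_conj, Complex.normSq_eq_norm_sq] at h
    rw [integral_complex_ofReal, Complex.ofReal_eq_zero, integral_eq_zero_iff_of_nonneg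
      (fun w => sq_nonneg _) (integrable_of_continuous hq hσ.carrier
        (g := fun w => ‖Q.eval (adjEigenvalue q w)‖ ^ 2) ((hcont Q).norm.pow 2))] at h
    have hae : ∀ᵐ w ∂σ, w ∈ spectralSet q := hσ.carrier
    have : ∀ᵐ w ∂σ, w ∈ (S : Set ℂ) := by
      filter_upwards [h, hae] with w hw hwΛ
      have : Q.eval (adjEigenvalue q w) = 0 := by simpa using hw
      obtain ⟨j, hj⟩ := (hQ0 _).1 this
      rw [← hza j] at hj
      rw [adjEigenvalue_injOn hq hwΛ (hz j) hj]
      simp [hS]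
    exact this
  have hmass : ∀ j, σ {z j} = ENNReal.ofReal (c j) := by
    intro j
    set p : Polynomial ℂ := Lagrange.basis Finset.univ (fun j => (a j : ℂ)) j with hp
    have hinj : Set.InjOn (fun j => (a j : ℂ)) (Finset.univ : Finset ι) := fun j _ k _ h =>
      ha (Complex.ofReal_injective h)
    have hp1 : p.eval (a j : ℂ) = 1 := Lagrange.eval_basis_self hinj (Finset.mem_univ j)
    have hp0 : ∀ k, k ≠ j → p.eval (a k : ℂ) = 0 := fun k hk =>
      Lagrange.eval_basis_of_ne (v := fun j => (a j : ℂ)) hk.symm (Finset.mem_univ k)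
    have h := hpoly p 1
    rw [Finset.sum_eq_single j (fun k _ hk => by rw [hp0 k hk, zero_mul, smul_zero]) (by simp),
      hp1] at h
    have hfin : (fun w => p.eval (adjEigenvalue q w) *
        (starRingEnd ℂ) ((1 : Polynomial ℂ).eval (adjEigenvalue q w))) =ᵐ[σ]
        ({z j} : Set ℂ).indicator fun _ => (1 : ℂ) := by
      have hae : ∀ᵐ w ∂σ, w ∈ (S : Set ℂ) := hsupp
      filter_upwards [hae] with w hw
      simp only [hS, Finset.coe_image, Finset.coe_univ, Set.image_univ, Set.mem_range] at hw
      obtain ⟨k, rfl⟩ := hw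
      rw [hza]
      by_cases hk : k = j
      · subst hk
        simp [hp1]
      · rw [hp0 k hk, Set.indicator_of_notMem (by simpa using fun h => hk (hzinj h)), zero_mul]
    rw [integral_congr_ae hfin, integral_indicator_const _ (measurableSet_singleton _)] at h
    have h' : σ.real {z j} = c j := by simpa using h
    rw [← h', ofReal_measureReal]
  ext A hA
  have hσA : σ A = σ ((S.filter (· ∈ A) : Finset ℂ) : Set ℂ) := by
    refine measure_congr ?_
    have hae : ∀ᵐ w ∂σ, w ∈ (S : Set ℂ) := hsupp
    filter_upwards [hae] with w hw
    refine propext ?_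
    change w ∈ A ↔ w ∈ ((S.filter (· ∈ A) : Finset ℂ) : Set ℂ)
    rw [Finset.coe_filter]
    exact ⟨fun h => ⟨hw, h⟩, fun h => h.2⟩
  rw [hσA, ← sum_measure_singleton, Finset.sum_filter, hS, Finset.sum_image fun j _ k _ h =>
    hzinj h, atomicMeasure, Measure.finsetSum_apply]
  refine Finset.sum_congr rfl fun j _ => ?_
  rw [hmass, Measure.smul_apply, Measure.dirac_apply' _ hA, Set.indicator_apply]
  simp

theorem subOscNumberVariance_atomicMeasure [Fintype ι] [T.LocallyFinite] {q : ℕ} (hq : 2 ≤ q)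
    (hT : T.IsTree) (hreg : T.IsRegularOfDegree (q + 1)) {a c : ι → ℝ} {z : ι → ℂ}
    (hc : ∀ j, 0 ≤ c j) (hza : ∀ j, adjEigenvalue q (z j) = a j) (r : ℕ) :
    subOscNumberVariance T o q (atomicMeasure c z) r =
      ∑ j, c j * (spectralSet q \ {trivialParam, signParam q}).indicator
        (fun _ => ballPoly q (a j) r ^ 2) (z j) := by
  have hmeas : MeasurableSet (spectralSet q \ {trivialParam, signParam q}) :=
    (measurableSet_spectralSet q).diff (Set.toFinite _).measurableSet
  classical
  rw [subOscNumberVariance, ← integral_indicator hmeas, integral_atomicMeasure hc]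
  refine Finset.sum_congr rfl fun j _ => ?_
  rw [smul_eq_mul]
  congr 1
  rw [Set.indicator_apply, Set.indicator_apply]
  split_ifs
  · rw [(hasHeckePoly_ball hT hreg r).sphericalTransform_eq hq hT hreg, hza]
    have h := map_ballPoly (Polynomial.evalRingHom (a j : ℂ)) q Polynomial.X r
    have h' := map_ballPoly Complex.ofRealHom q (a j) r
    simp only [Polynomial.coe_evalRingHom, Polynomial.eval_X, Complex.ofRealHom_eq_coe] at h h'
    rw [h, ← h', Complex.norm_real, Real.norm_eq_abs, sq_abs]
  · rfl

/-- The diffraction measure of a fundamental group orbit is the spectral measure of the adjacency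
operator at the base point, divided by the number of vertices. -/
theorem isDiffractionMeasure_iff [Fintype ι] [Fintype W] [DecidableRel X.Adj] [T.LocallyFinite]
    {q : ℕ} (hq : 2 ≤ q) {a : ι → ℝ} {F : ι → W → ℝ}
    (hF : IsSpectralDecomposition (X := X) u a F) (hX : X.Connected)
    (hXreg : X.IsRegularOfDegree (q + 1)) (hXtrans : ∀ v, ∃ β : X ≃g X, β u = v)
    (hT : T.IsTree) (hreg : T.IsRegularOfDegree (q + 1)) {z : ι → ℂ}
    (hz : ∀ j, z j ∈ spectralSet q) (hza : ∀ j, adjEigenvalue q (z j) = a j)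
    {μ : Measure (Config V)} (hμ : IsFundamentalGroupOrbit X u T o μ) (σ : Measure ℂ) :
    IsDiffractionMeasure T o q μ σ ↔ σ = atomicMeasure (fun j => F j u / Fintype.card W) z := by
  have hc : ∀ j, 0 ≤ F j u / Fintype.card W := fun j => div_nonneg (hF.nonneg j) (by positivity)
  have h := fun f₁ f₂ p₁ p₂ (h₁ : HasHeckePoly T o f₁ p₁) (h₂ : HasHeckePoly T o f₂ p₂) =>
    integral_linearStatistic hF hX hXreg hXtrans hreg hμ h₁ h₂
  constructor
  · exact fun hσ => hσ.eq_atomicMeasure hq hT hreg hc hF.injective hz hza h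
  · rintro rfl
    exact isDiffractionMeasure_atomicMeasure hq hT hreg hc hz hza h

theorem finsum_ball_orbitConfig [Fintype ι] [Fintype W] [DecidableRel X.Adj]
    [T.LocallyFinite] {q : ℕ} (hT : T.IsTree) (hreg : T.IsRegularOfDegree (q + 1))
    {Γ : Subgroup (T ≃g T)} {π : V → W} {a : ι → ℝ} {F : ι → W → ℝ}
    (hF : IsSpectralDecomposition (X := X) u a F) (hπ : IsOrbitCovering X u T o Γ π)
    (c : (T ≃g T) ⧸ Γ) (r : ℕ) :
    ∑ᶠ x ∈ ball T o r, (orbitConfig Γ o c x : ℝ) =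
      ∑ j, ballPoly q (a j) r * F j (cosetLabel hπ c o) := by
  classical
  have h1 : ∀ x, (orbitConfig Γ o c x : ℝ) = ∑ j, F j (cosetLabel hπ c x) := by
    intro x
    rw [orbitConfig_eq hπ]
    split_ifs with hx
    · rw [hx, hF.sum_eq_one]; simp
    · rw [hF.sum_eq_zero _ hx]; simp
  rw [finsum_mem_ball hT]
  simp only [h1, ballPoly]
  rw [Finset.sum_congr rfl fun n _ => Finset.sum_comm, Finset.sum_comm]
  refine Finset.sum_congr rfl fun j _ => ?_
  rw [Finset.sum_mul]
  refine Finset.sum_congr rfl fun n _ => ?_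
  rw [sum_sphere_eigenfunction hT hreg fun x => ?_]
  rw [sum_neighbors_cosetLabel hπ c x (F j), hF.sum_neighbors]

/-- The constant component of the spectral decomposition is the mean of the number of points, so
the variance collects the other components. -/
theorem numberVariance_eq [Fintype ι] [DecidableEq ι] [Fintype W] [DecidableRel X.Adj]
    [T.LocallyFinite]
    {q : ℕ} {a : ι → ℝ} {F : ι → W → ℝ}
    (hF : IsSpectralDecomposition (X := X) u a F) {j₀ : ι}
    (hconst : ∀ w, F j₀ w = 1 / Fintype.card W) (hX : X.Connected)
    (hXreg : X.IsRegularOfDegree (q + 1)) (hXtrans : ∀ v, ∃ β : X ≃g X, β u = v)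
    (hT : T.IsTree) (hreg : T.IsRegularOfDegree (q + 1)) {μ : Measure (Config V)}
    (hμ : IsFundamentalGroupOrbit X u T o μ) (r : ℕ) :
    numberVariance T o μ r =
      ∑ j ∈ Finset.univ.erase j₀, F j u / Fintype.card W * ballPoly q (a j) r ^ 2 := by
  obtain ⟨i, hi, m, hm, hinv, rfl⟩ := hμ
  have hπ := isOrbitCovering_fst X u i hi
  have hcard : (Fintype.card W : ℝ) ≠ 0 := by
    have : Nonempty W := ⟨u⟩
    exact_mod_cast Fintype.card_ne_zero
  have hmeas : Measurable fun p : Config V => ∑ᶠ x ∈ ball T o r, (p x : ℝ) := by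
    simp only [finsum_mem_ball hT]
    fun_prop
  have hsum : ∀ w (b : ι → ℝ), ∑ j, b j * F j w =
      ∑ j ∈ Finset.univ.erase j₀, b j * F j w + b j₀ / Fintype.card W := fun w b => by
    rw [← Finset.sum_erase_add _ _ (Finset.mem_univ j₀), hconst, mul_one_div]
  have hint : ∀ G : W → ℝ, ∫ c, G (cosetLabel hπ c o) ∂m =
      (∑ w, G w) / Fintype.card W := fun G => by
    rw [integral_comp_cosetLabel m hπ o G]
    simp only [measureReal_cosetLabel m hπ (exists_aut_apply_root i hi hXtrans) hX hXreg hreg]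
    rw [← Finset.smul_sum, smul_eq_mul, one_div_mul_eq_div]
  have hzero : ∀ j, j ≠ j₀ → ∑ w, F j w = 0 := fun j hj => by
    have h := hF.sum_mul j j₀
    simp only [hconst, if_neg hj, ← Finset.sum_mul] at h
    simpa [hcard] using h
  have hmean : ∫ c, ∑ j, ballPoly q (a j) r * F j (cosetLabel hπ c o) ∂m =
      ballPoly q (a j₀) r / Fintype.card W := by
    rw [hint fun w => ∑ j, ballPoly q (a j) r * F j w]
    simp only [hsum _ fun j => ballPoly q (a j) r]
    rw [Finset.sum_add_distrib, Finset.sum_comm]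
    simp only [← Finset.mul_sum]
    rw [Finset.sum_eq_zero fun j hj => by rw [hzero j (Finset.ne_of_mem_erase hj), mul_zero]]
    simp
    field_simp
  rw [numberVariance, variance_map hmeas.aemeasurable (measurable_orbitConfig hπ).aemeasurable,
    variance_eq_integral (hmeas.comp (measurable_orbitConfig hπ)).aemeasurable]
  simp only [Function.comp_apply, finsum_ball_orbitConfig hT hreg hF hπ, hmean]
  simp only [hsum _ fun j => ballPoly q (a j) r, add_sub_cancel_right]
  rw [hint fun w => (∑ j ∈ Finset.univ.erase j₀, ballPoly q (a j) r * F j w) ^ 2]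
  have h : ∑ w, (∑ j ∈ Finset.univ.erase j₀, ballPoly q (a j) r * F j w) ^ 2 =
      ∑ j ∈ Finset.univ.erase j₀, ∑ k ∈ Finset.univ.erase j₀,
        ballPoly q (a j) r * ballPoly q (a k) r * ∑ w, F j w * F k w := by
    simp only [sq, Finset.sum_mul_sum]
    rw [Finset.sum_comm]
    refine Finset.sum_congr rfl fun j _ => ?_
    rw [Finset.sum_comm]
    refine Finset.sum_congr rfl fun k _ => ?_
    rw [Finset.mul_sum]
    exact Finset.sum_congr rfl fun w _ => by ring
  rw [h, Finset.sum_div]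
  refine Finset.sum_congr rfl fun j hj => ?_
  rw [Finset.sum_eq_single j]
  · rw [hF.sum_mul, if_pos rfl]
    ring
  · intro k _ hk
    rw [hF.sum_mul, if_neg hk.symm, mul_zero]
  · exact fun h => absurd hj h

end Diffraction


/-! ### Asymptotics of ball polynomials -/

section Asymptotics

theorem sin_mul_ballPoly {q : ℕ} (hq : 2 ≤ q) (θ : ℝ) (n : ℕ) :
    Real.sin θ * ballPoly q (2 * √(q : ℝ) * Real.cos θ) n =
      √(q : ℝ) ^ n * (Real.sin ((n + 1) * θ) + Real.sin (n * θ) / √(q : ℝ)) := by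
  have hq0 : (0 : ℝ) < q := by exact_mod_cast (by omega : 0 < q)
  have hs : √(q : ℝ) ≠ 0 := (Real.sqrt_pos.2 hq0).ne'
  have hs2 : √(q : ℝ) * √(q : ℝ) = q := Real.mul_self_sqrt hq0.le
  have hsin : ∀ x : ℝ, Real.sin ((x + 2) * θ) =
      2 * Real.cos θ * Real.sin ((x + 1) * θ) - Real.sin (x * θ) := fun x => by
    rw [show (x + 2) * θ = (x + 1) * θ + θ by ring, show x * θ = (x + 1) * θ - θ by ring,
      Real.sin_add, Real.sin_sub]
    ring
  induction n using Nat.strong_induction_on with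
  | _ n ih =>
  match n with
  | 0 => simp [ballPoly_zero]
  | 1 =>
    rw [ballPoly_one]
    have h := Real.sin_two_mul θ
    norm_num
    rw [h]
    field_simp
    ring
  | n + 2 =>
    rw [ballPoly_add_two, mul_sub, mul_left_comm, ih (n + 1) (by omega),
      mul_left_comm (Real.sin θ) (q : ℝ), ih n (by omega)]
    have h1 := hsin (n + 1)
    have h2 := hsin n
    push_cast
    rw [show ((n : ℝ) + 2 + 1) = n + 1 + 2 by ring, h1, h2,
      show ((n : ℝ) + 1 + 1) = n + 2 by ring, h2]
    generalize √(q : ℝ) = s at *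
    rw [← hs2]
    field_simp
    ring

/-- For a tempered eigenvalue the ball polynomials oscillate at the scale `q ^ (r / 2)`. -/
theorem exists_ballPoly_sq_eq {q : ℕ} (hq : 2 ≤ q) {a : ℝ} (ha : a ^ 2 < 4 * q) :
    ∃ C φ : ℝ, ∀ r : ℕ, ballPoly q a r ^ 2 =
      q ^ r * (C * Real.sin (r * Real.arccos (a / (2 * √(q : ℝ))) + φ)) ^ 2 := by
  have hq0 : (0 : ℝ) < q := by exact_mod_cast (by omega : 0 < q)
  have hs : 0 < √(q : ℝ) := Real.sqrt_pos.2 hq0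
  have hs2 := Real.sq_sqrt hq0.le
  have habs : |a| < 2 * √(q : ℝ) := abs_lt_of_sq_lt_sq (by nlinarith) (by positivity)
  have h1 : -1 < a / (2 * √(q : ℝ)) := by
    rw [lt_div_iff₀ (by positivity)]; linarith [(abs_lt.1 habs).1]
  have h2 : a / (2 * √(q : ℝ)) < 1 := by
    rw [div_lt_iff₀ (by positivity)]; linarith [(abs_lt.1 habs).2]
  set θ := Real.arccos (a / (2 * √(q : ℝ))) with hθ
  have hcos : 2 * √(q : ℝ) * Real.cos θ = a := by
    rw [hθ, Real.cos_arccos h1.le h2.le]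
    field_simp
  have hsin : 0 < Real.sin θ := by
    refine Real.sin_pos_of_pos_of_lt_pi (Real.arccos_pos.2 h2) ?_
    refine lt_of_le_of_ne (Real.arccos_le_pi _) fun h => ?_
    rw [Real.arccos_eq_pi] at h
    linarith
  -- The amplitude and the phase are those of `e^{iθ} + q^{-1/2}`.
  set w : ℂ := ⟨Real.cos θ + 1 / √(q : ℝ), Real.sin θ⟩ with hw
  refine ⟨‖w‖ / Real.sin θ, w.arg, fun r => ?_⟩
  have hre : ‖w‖ * Real.cos w.arg = Real.cos θ + 1 / √(q : ℝ) := Complex.norm_mul_cos_arg w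
  have him : ‖w‖ * Real.sin w.arg = Real.sin θ := Complex.norm_mul_sin_arg w
  have h := sin_mul_ballPoly hq θ r
  rw [hcos] at h
  have hP : ballPoly q a r =
      √(q : ℝ) ^ r * (‖w‖ / Real.sin θ * Real.sin (r * θ + w.arg)) := by
    apply mul_left_cancel₀ hsin.ne'
    rw [h, Real.sin_add, show ((r : ℝ) + 1) * θ = r * θ + θ by ring, Real.sin_add]
    have : Real.sin θ * (√(q : ℝ) ^ r * (‖w‖ / Real.sin θ * (Real.sin (r * θ) * Real.cos w.arg +
        Real.cos (r * θ) * Real.sin w.arg))) = √(q : ℝ) ^ r * (Real.sin (r * θ) *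
        (‖w‖ * Real.cos w.arg) + Real.cos (r * θ) * (‖w‖ * Real.sin w.arg)) := by
      field_simp
    rw [this, hre, him]
    ring
  rw [hP, mul_pow, ← pow_mul, mul_comm r 2, pow_mul, hs2]

theorem irrational_arccos {q : ℕ} (hq : 2 ≤ q) {a : ℝ} (ha : a ^ 2 = 1) :
    Irrational (Real.arccos (a / (2 * √(q : ℝ))) / Real.pi) := by
  have hq2 : (2 : ℝ) ≤ q := by exact_mod_cast hq
  have hs : 0 < √(q : ℝ) := Real.sqrt_pos.2 (by linarith)
  have hs2 : √(q : ℝ) ^ 2 = q := Real.sq_sqrt (by linarith)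
  have hsq : (a / (2 * √(q : ℝ))) ^ 2 = 1 / (4 * q) := by
    rw [div_pow, ha, mul_pow, hs2]; norm_num
  have habs : |a / (2 * √(q : ℝ))| ≤ 1 := by
    rw [← sq_le_one_iff_abs_le_one, hsq, div_le_one (by linarith)]
    linarith
  rintro ⟨ρ, hρ⟩
  have hθ : Real.arccos (a / (2 * √(q : ℝ))) = ρ * Real.pi := by
    rw [hρ, div_mul_cancel₀ _ Real.pi_ne_zero]
  -- `cos (2θ) = 1/(2q) - 1` lies strictly between `-1` and `-1/2`, where Niven's theorem allows
  -- no rational value.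
  have hcos : Real.cos (2 * Real.arccos (a / (2 * √(q : ℝ)))) = 1 / (2 * q) - 1 := by
    rw [Real.cos_two_mul, Real.cos_arccos (abs_le.1 habs).1 (abs_le.1 habs).2, hsq]
    field_simp
    ring
  have h := niven (θ := 2 * Real.arccos (a / (2 * √(q : ℝ))))
    ⟨2 * ρ, by rw [hθ]; push_cast; ring⟩ ⟨1 / (2 * q) - 1, by rw [hcos]; push_cast; ring⟩
  rw [hcos] at h
  have hpos : 0 < 1 / (2 * (q : ℝ)) := by positivity
  have hle : 1 / (2 * (q : ℝ)) ≤ 1 / 4 := by gcongr; linarith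
  simp only [Set.mem_insert_iff, Set.mem_singleton_iff] at h
  rcases h with h | h | h | h | h <;> linarith

theorem frequently_sin_lt {α : ℝ} (hα : Irrational (α / Real.pi)) (φ : ℝ) {ε : ℝ} (hε : 0 < ε) :
    ∃ᶠ k : ℕ in atTop, |Real.sin (k * α + φ)| < ε := by
  have : Fact (0 < 2 * Real.pi) := ⟨Real.two_pi_pos⟩
  have hirr : Irrational (α / (2 * Real.pi)) := by
    have := hα.div_natCast (two_ne_zero)
    rwa [div_div, mul_comm, Nat.cast_ofNat] at this
  have hdense := AddCircle.denseRange_zsmul_coe_iff.2 hirr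
  have hmem : ((-φ : ℝ) : AddCircle (2 * Real.pi)) ∈
      (AddSubgroup.zmultiples (α : AddCircle (2 * Real.pi))).topologicalClosure := by
    have := hdense (-φ : ℝ)
    rwa [← SetLike.mem_coe, AddSubgroup.topologicalClosure_coe, AddSubgroup.coe_zmultiples]
  have hclust := mapClusterPt_atTop_nsmul_iff_mem_topologicalClosure_zmultiples.2 hmem
  let g : Real.Angle → ℝ := fun x => |Real.Angle.sin (x + (φ : ℝ))|
  have hg : Continuous (X := AddCircle (2 * Real.pi)) g :=
    (Real.Angle.continuous_sin.comp (continuous_add_const (φ : Real.Angle))).abs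
  have hg0 : g ((-φ : ℝ) : AddCircle (2 * Real.pi)) < ε := by
    change |Real.Angle.sin (((-φ : ℝ) : Real.Angle) + ((φ : ℝ) : Real.Angle))| < ε
    rw [← Real.Angle.coe_add, Real.Angle.sin_coe]
    simpa using hε
  have h := hclust.frequently (hg.continuousAt.eventually (gt_mem_nhds hg0))
  refine h.mono fun k hk => ?_
  change |Real.Angle.sin (k • (α : Real.Angle) + ((φ : ℝ) : Real.Angle))| < ε at hk
  rwa [← Real.Angle.natCast_mul_eq_nsmul, ← Real.Angle.coe_add, Real.Angle.sin_coe] at hk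

variable {V : Type*} {T : SimpleGraph V} {o : V}

theorem liminfPerVolume_eq_zero [T.LocallyFinite] {q : ℕ} (hT : T.IsTree)
    (hreg : T.IsRegularOfDegree (q + 1)) (hq : 2 ≤ q) {F : ℕ → ℝ} (hF : ∀ r, 0 ≤ F r)
    (h : ∀ ε : ℝ, 0 < ε → ∃ᶠ r in atTop, F r ≤ ε * q ^ r) : liminfPerVolume T o F = 0 := by
  have hq0 : (0 : ℝ) < q := by exact_mod_cast (by omega : 0 < q)
  refine le_antisymm ?_ ?_
  · refine EReal.le_of_forall_lt_iff_le.1 fun ε hε => ?_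
    have hε' : 0 < ε := by exact_mod_cast hε
    refine liminf_le_of_frequently_le' ((h ε hε').mono fun r hr => ?_)
    rw [EReal.coe_le_coe_iff, ncard_ball hT hreg]
    have hb := pow_le_ballPoly q r
    have hpow : 0 < (q : ℝ) ^ r := by positivity
    rw [div_le_iff₀ (by linarith)]
    exact hr.trans (by gcongr)
  · refine le_liminf_of_le (by isBoundedDefault) (Eventually.of_forall fun r => ?_)
    exact_mod_cast div_nonneg (hF r) (Nat.cast_nonneg _)

theorem liminfPerVolume_pos [T.LocallyFinite] {q : ℕ} (hT : T.IsTree)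
    (hreg : T.IsRegularOfDegree (q + 1)) (hq : 2 ≤ q) {F : ℕ → ℝ} {b : ℝ} (hb : 0 < b)
    (h : ∀ r, b * q ^ r ≤ F r) : 0 < liminfPerVolume T o F := by
  have hq0 : (0 : ℝ) < q := by exact_mod_cast (by omega : 0 < q)
  refine lt_of_lt_of_le (b := ((b / 3 : ℝ) : EReal)) (by exact_mod_cast (by positivity)) ?_
  refine le_liminf_of_le (by isBoundedDefault) (Eventually.of_forall fun r => ?_)
  rw [EReal.coe_le_coe_iff, ncard_ball hT hreg]
  have hpow : 0 < (q : ℝ) ^ r := by positivity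
  rw [le_div_iff₀ (hpow.trans_le (pow_le_ballPoly q r))]
  refine le_trans ?_ (h r)
  calc b / 3 * ballPoly q (q + 1 : ℝ) r ≤ b / 3 * (3 * q ^ r) := by
        gcongr
        exact ballPoly_le hq r
    _ = b * q ^ r := by ring

/-- Along every arithmetic progression the ball polynomials at the eigenvalues `±1` are frequently
small, since their phase advances by an irrational angle. -/
theorem frequently_ballPoly_sq_le {q : ℕ} (hq : 2 ≤ q) {a : ℝ} (ha : a ^ 2 = 1) {d : ℕ}
    (hd : d ≠ 0) (b : ℕ) {ε : ℝ} (hε : 0 < ε) :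
    ∃ᶠ k : ℕ in atTop, ballPoly q a (d * k + b) ^ 2 ≤ ε * q ^ (d * k + b) := by
  have hq2 : (2 : ℝ) ≤ q := by exact_mod_cast hq
  obtain ⟨C, φ, h⟩ := exists_ballPoly_sq_eq hq (a := a) (by rw [ha]; linarith)
  set θ := Real.arccos (a / (2 * √(q : ℝ)))
  have hirr : Irrational (d * θ / Real.pi) := by
    rw [mul_div_assoc]
    exact (irrational_arccos hq ha).natCast_mul hd
  have hC : 0 < |C| + 1 := by positivity
  have hε' : 0 < √ε / (|C| + 1) := div_pos (Real.sqrt_pos.2 hε) hC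
  refine (frequently_sin_lt hirr (b * θ + φ) hε').mono fun k hk => ?_
  rw [h, mul_comm]
  gcongr
  have harg : ((d * k + b : ℕ) : ℝ) * θ + φ = k * (d * θ) + (b * θ + φ) := by push_cast; ring
  rw [harg, ← Real.sq_sqrt hε.le, sq_le_sq, abs_of_nonneg (Real.sqrt_nonneg ε), abs_mul]
  rw [lt_div_iff₀ hC] at hk
  nlinarith [abs_nonneg (Real.sin (k * (d * θ) + (b * θ + φ)))]

theorem pow_le_ballPoly_zero_sq {q : ℕ} (hq : 2 ≤ q) (n : ℕ) :
    (q : ℝ) ^ n ≤ q * ballPoly q (0 : ℝ) n ^ 2 := by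
  have hq2 : (2 : ℝ) ≤ q := by exact_mod_cast hq
  induction n using Nat.strong_induction_on with
  | _ n ih =>
  match n with
  | 0 => simp [ballPoly_zero]; omega
  | 1 => simp [ballPoly_one]
  | n + 2 =>
    rw [ballPoly_add_two, pow_add]
    have h := ih n (by omega)
    have h2 : (q : ℝ) * (0 * ballPoly q 0 (n + 1) - q * ballPoly q 0 n) ^ 2 =
      (q * ballPoly q (0 : ℝ) n ^ 2) * q ^ 2 := by ring
    rw [h2]
    gcongr

/-- For `q = 2` and the eigenvalue `-2` the phase is a multiple of `π / 4`, and the ball polynomials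
vanish along an arithmetic progression. -/
theorem ballPoly_two_neg_two (k : ℕ) : ballPoly 2 (-2 : ℝ) (4 * k + 2) = 0 := by
  have h : ∀ n, ballPoly 2 (-2 : ℝ) (n + 4) = -4 * ballPoly 2 (-2 : ℝ) n := fun n => by
    rw [ballPoly_add_two, ballPoly_add_two, ballPoly_add_two]
    push_cast
    ring
  induction k with
  | zero => rw [mul_zero, ballPoly_add_two, ballPoly_one, ballPoly_zero]; norm_num
  | succ k ih => rw [show 4 * (k + 1) + 2 = 4 * k + 2 + 4 by ring, h, ih, mul_zero]

end Asymptotics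


/-! ### The complete graph -/

section CompleteGraph

variable {q : ℕ}

theorem isRegularOfDegree_top (q : ℕ) :
    (⊤ : SimpleGraph (Fin (q + 2))).IsRegularOfDegree (q + 1) := fun v => by
  rw [SimpleGraph.complete_graph_degree, Fintype.card_fin]
  rfl

theorem exists_iso_top (u v : Fin (q + 2)) :
    ∃ β : (⊤ : SimpleGraph (Fin (q + 2))) ≃g (⊤ : SimpleGraph (Fin (q + 2))), β u = v :=
  ⟨SimpleGraph.Iso.completeGraph (Equiv.swap u v), Equiv.swap_apply_left u v⟩

/-- Eigenvalues of the complete graph on `q + 2` vertices. -/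
def completeEigenvalues (q : ℕ) : Fin 2 → ℝ := ![q + 1, -1]

/-- Spectral components of the point mass at `u` in the complete graph on `q + 2` vertices. -/
noncomputable def completeComponents (u : Fin (q + 2)) : Fin 2 → Fin (q + 2) → ℝ :=
  ![fun _ => 1 / (q + 2), fun w => (if w = u then 1 else 0) - 1 / (q + 2)]

theorem isSpectralDecomposition_top (u : Fin (q + 2)) :
    IsSpectralDecomposition (X := (⊤ : SimpleGraph (Fin (q + 2)))) u (completeEigenvalues q)
      (completeComponents u) where
  injective := by
    have hq : (0 : ℝ) ≤ q := Nat.cast_nonneg q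
    intro j k h
    fin_cases j <;> fin_cases k <;> simp [completeEigenvalues] at h ⊢ <;> linarith
  sum_neighbors j w := by
    have hq : (q : ℝ) + 2 ≠ 0 := by positivity
    have h : ∀ g : Fin (q + 2) → ℝ,
        ∑ w' ∈ (⊤ : SimpleGraph (Fin (q + 2))).neighborFinset w, g w' = ∑ w', g w' - g w := by
      intro g
      rw [← Finset.sum_erase_eq_sub (Finset.mem_univ w)]
      refine Finset.sum_congr ?_ fun _ _ => rfl
      ext w'
      simp [eq_comm]
    rw [h]
    fin_cases j
    · simp [completeComponents, completeEigenvalues]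
      field_simp
      ring
    · simp [completeComponents, completeEigenvalues, Finset.sum_sub_distrib]
      field_simp
      ring
  sum_eq_one := by simp [completeComponents]
  sum_eq_zero w hw := by simp [completeComponents, hw]

/-- The spectral parameters of the eigenvalues of the complete graph. -/
noncomputable def completeParams (q : ℕ) : Fin 2 → ℂ := ![trivialParam, temperedParam q (-1)]

end CompleteGraph

/-! ### The complete bipartite graph -/

section CompleteBipartite

variable {n : ℕ}

instance : DecidableRel (completeBipartiteGraph (Fin n) (Fin n)).Adj := fun v w =>
  inferInstanceAs (Decidable (v.isLeft ∧ w.isRight ∨ v.isRight ∧ w.isLeft))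

theorem sum_neighbors_bipartite {R : Type*} [AddCommMonoid R] (w : Fin n ⊕ Fin n)
    (g : Fin n ⊕ Fin n → R) :
    ∑ w' ∈ (completeBipartiteGraph (Fin n) (Fin n)).neighborFinset w, g w' =
      Sum.elim (fun _ => ∑ b, g (.inr b)) (fun _ => ∑ b, g (.inl b)) w := by
  rw [SimpleGraph.neighborFinset_eq_filter, Finset.sum_filter, Fintype.sum_sum_type]
  rcases w with a | a <;> simp

theorem isRegularOfDegree_bipartite (n : ℕ) :
    (completeBipartiteGraph (Fin n) (Fin n)).IsRegularOfDegree n := fun v => by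
  rw [← SimpleGraph.card_neighborFinset_eq_degree, Finset.card_eq_sum_ones,
    sum_neighbors_bipartite]
  rcases v with a | a <;> simp

theorem connected_bipartite (q : ℕ) :
    (completeBipartiteGraph (Fin (q + 1)) (Fin (q + 1))).Connected where
  preconnected v w := by
    have h : ∀ a b, (completeBipartiteGraph (Fin (q + 1)) (Fin (q + 1))).Reachable
        (.inl a) (.inr b) := fun a b => SimpleGraph.Adj.reachable (by simp)
    rcases v with a | a <;> rcases w with b | b
    · exact (h a 0).trans (h b 0).symm
    · exact h a b
    · exact (h b a).symm
    · exact (h 0 a).symm.trans (h 0 b)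
  nonempty := ⟨.inl 0⟩

theorem exists_iso_bipartite (u v : Fin n ⊕ Fin n) :
    ∃ β : completeBipartiteGraph (Fin n) (Fin n) ≃g completeBipartiteGraph (Fin n) (Fin n),
      β u = v := by
  let s (a b : Fin n) :
      completeBipartiteGraph (Fin n) (Fin n) ≃g completeBipartiteGraph (Fin n) (Fin n) :=
    ⟨Equiv.sumCongr (Equiv.swap a b) (Equiv.swap a b), by rintro (x | x) (y | y) <;> simp⟩
  let t : completeBipartiteGraph (Fin n) (Fin n) ≃g completeBipartiteGraph (Fin n) (Fin n) :=
    ⟨Equiv.sumComm _ _, by rintro (x | x) (y | y) <;> simp⟩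
  have hl : ∀ a b, s a b (.inl a) = .inl b := fun a b =>
    congrArg Sum.inl (Equiv.swap_apply_left a b)
  have hr : ∀ a b, s a b (.inr a) = .inr b := fun a b =>
    congrArg Sum.inr (Equiv.swap_apply_left a b)
  rcases u with a | a <;> rcases v with b | b
  · exact ⟨s a b, hl a b⟩
  · exact ⟨t.trans (s a b), hr a b⟩
  · exact ⟨t.trans (s a b), hl a b⟩
  · exact ⟨s a b, hr a b⟩

/-- Eigenvalues of the complete bipartite graph `K_{q+1,q+1}`. -/
def bipartiteEigenvalues (q : ℕ) : Fin 3 → ℝ := ![q + 1, -(q + 1), 0]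

/-- Spectral components of the point mass at `u` in the complete bipartite graph `K_{q+1,q+1}`. -/
noncomputable def bipartiteComponents {q : ℕ} (u : Fin (q + 1) ⊕ Fin (q + 1)) :
    Fin 3 → Fin (q + 1) ⊕ Fin (q + 1) → ℝ :=
  ![fun _ => 1 / (2 * (q + 1)),
    fun w => (if w.isLeft = u.isLeft then 1 else -1) / (2 * (q + 1)),
    fun w => (if w = u then 1 else 0) - (if w.isLeft = u.isLeft then (1 / (q + 1) : ℝ) else 0)]

theorem isSpectralDecomposition_bipartite {q : ℕ} (u : Fin (q + 1) ⊕ Fin (q + 1)) :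
    IsSpectralDecomposition (X := completeBipartiteGraph (Fin (q + 1)) (Fin (q + 1))) u
      (bipartiteEigenvalues q) (bipartiteComponents u) where
  injective := by
    have hq : (0 : ℝ) ≤ q := Nat.cast_nonneg q
    intro j k h
    fin_cases j <;> fin_cases k <;> simp [bipartiteEigenvalues] at h ⊢ <;> linarith
  sum_neighbors j w := by
    have hq : (q : ℝ) + 1 ≠ 0 := by positivity
    rw [sum_neighbors_bipartite]
    rcases u with u | u <;> rcases w with w | w <;> fin_cases j <;>
      simp [bipartiteComponents, bipartiteEigenvalues, Finset.sum_sub_distrib] <;>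
      field_simp <;> norm_num
  sum_eq_one := by
    have hq : (q : ℝ) + 1 ≠ 0 := by positivity
    simp [bipartiteComponents, Fin.sum_univ_three]
    field_simp
    ring
  sum_eq_zero w hw := by
    have hq : (q : ℝ) + 1 ≠ 0 := by positivity
    simp only [bipartiteComponents, Fin.sum_univ_three, Matrix.cons_val, if_neg hw]
    split_ifs <;> field_simp <;> norm_num

/-- The spectral parameters of the eigenvalues of `K_{q+1,q+1}`. -/
noncomputable def bipartiteParams (q : ℕ) : Fin 3 → ℂ :=
  ![trivialParam, signParam q, temperedParam q 0]

end CompleteBipartite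

/-! ### The Petersen graph -/

section Petersen

instance : DecidableRel petersenGraph.Adj
  | .inl a, .inl b => inferInstanceAs (Decidable (b = a + 1 ∨ a = b + 1))
  | .inr a, .inr b => inferInstanceAs (Decidable (b = a + 2 ∨ a = b + 2))
  | .inl a, .inr b => inferInstanceAs (Decidable (a = b))
  | .inr a, .inl b => inferInstanceAs (Decidable (a = b))

theorem isRegularOfDegree_petersen : petersenGraph.IsRegularOfDegree (2 + 1) := by
  unfold SimpleGraph.IsRegularOfDegree
  decide

theorem connected_petersen : petersenGraph.Connected where
  preconnected v w := by
    have h : ∀ v w, v = w ∨ petersenGraph.Adj v w ∨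
        ∃ x, petersenGraph.Adj v x ∧ petersenGraph.Adj x w := by decide
    rcases h v w with rfl | h | ⟨x, h1, h2⟩
    · rfl
    · exact h.reachable
    · exact h1.reachable.trans h2.reachable
  nonempty := ⟨.inl 0⟩

/-- Rotation of the Petersen graph. -/
def petersenRotate (k : ZMod 5) : petersenGraph ≃g petersenGraph where
  toEquiv := Equiv.sumCongr (Equiv.addRight k) (Equiv.addRight k)
  map_rel_iff' := by revert k; decide

/-- The automorphism of the Petersen graph that interchanges the outer 5-cycle and the inner
pentagram: multiplication by `2` turns steps of length `1` into steps of length `2` and steps of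
length `2` into steps of length `-1`. -/
def petersenSwap : petersenGraph ≃g petersenGraph where
  toFun := Sum.elim (fun a => .inr (2 * a)) (fun a => .inl (2 * a))
  invFun := Sum.elim (fun a => .inr (3 * a)) (fun a => .inl (3 * a))
  left_inv := by unfold Function.LeftInverse; decide
  right_inv := by unfold Function.RightInverse Function.LeftInverse; decide
  map_rel_iff' := by decide

theorem exists_iso_petersen (u v : ZMod 5 ⊕ ZMod 5) :
    ∃ β : petersenGraph ≃g petersenGraph, β u = v := by
  have h : ∀ u v, ∃ k, petersenRotate k u = v ∨ petersenRotate k (petersenSwap u) = v := by decide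
  obtain ⟨k, hk | hk⟩ := h u v
  · exact ⟨petersenRotate k, hk⟩
  · exact ⟨petersenSwap.trans (petersenRotate k), hk⟩

/-- Eigenvalues of the Petersen graph. -/
def petersenEigenvalues : Fin 3 → ℝ := ![3, 1, -2]

/-- Six times the component of the point mass at `u` for the eigenvalue `1`. -/
def petersenComponentOne (u w : ZMod 5 ⊕ ZMod 5) : ℤ :=
  if w = u then 3 else if petersenGraph.Adj w u then 1 else -1

/-- Fifteen times the component of the point mass at `u` for the eigenvalue `-2`. -/
def petersenComponentTwo (u w : ZMod 5 ⊕ ZMod 5) : ℤ :=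
  if w = u then 6 else if petersenGraph.Adj w u then -4 else 1

/-- Spectral components of the point mass at `u` in the Petersen graph. -/
noncomputable def petersenComponents (u : ZMod 5 ⊕ ZMod 5) : Fin 3 → ZMod 5 ⊕ ZMod 5 → ℝ :=
  ![fun _ => 1 / 10, fun w => petersenComponentOne u w / 6,
    fun w => petersenComponentTwo u w / 15]

theorem sum_petersenComponentOne : ∀ u w, ∑ w' ∈ petersenGraph.neighborFinset w,
    petersenComponentOne u w' = petersenComponentOne u w := by
  decide

theorem sum_petersenComponentTwo : ∀ u w, ∑ w' ∈ petersenGraph.neighborFinset w,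
    petersenComponentTwo u w' = -2 * petersenComponentTwo u w := by
  decide

theorem isSpectralDecomposition_petersen (u : ZMod 5 ⊕ ZMod 5) :
    IsSpectralDecomposition (X := petersenGraph) u petersenEigenvalues (petersenComponents u) where
  injective := by
    intro j k h
    fin_cases j <;> fin_cases k <;> simp [petersenEigenvalues] at h ⊢ <;> norm_num at h
  sum_neighbors j w := by
    fin_cases j
    · simp [petersenComponents, petersenEigenvalues, isRegularOfDegree_petersen.degree_eq]
    · simp only [petersenComponents, petersenEigenvalues, Fin.mk_one, Matrix.cons_val]
      rw [← Finset.sum_div, ← Int.cast_sum, sum_petersenComponentOne, one_mul]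
    · simp only [petersenComponents, petersenEigenvalues, Fin.reduceFinMk, Matrix.cons_val]
      rw [← Finset.sum_div, ← Int.cast_sum, sum_petersenComponentTwo]
      push_cast
      ring
  sum_eq_one := by
    simp [petersenComponents, petersenComponentOne, petersenComponentTwo, Fin.sum_univ_three]
    norm_num
  sum_eq_zero w hw := by
    simp only [petersenComponents, petersenComponentOne, petersenComponentTwo, Fin.sum_univ_three,
      Matrix.cons_val, if_neg hw]
    split_ifs <;> norm_num

/-- The spectral parameters of the eigenvalues of the Petersen graph. -/
noncomputable def petersenParams : Fin 3 → ℂ :=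
  ![trivialParam, temperedParam 2 1, temperedParam 2 (-2)]

end Petersen


/-! ### Number variances of the three families -/

section NumberVariances

variable {V : Type*} {T : SimpleGraph V} {o : V} {q : ℕ}

theorem trivialParam_notMem : trivialParam ∉ spectralSet q \ {trivialParam, signParam q} :=
  fun h => h.2 (Set.mem_insert _ _)

theorem signParam_notMem : signParam q ∉ spectralSet q \ {trivialParam, signParam q} :=
  fun h => h.2 (Set.mem_insert_of_mem _ rfl)

theorem complete_diffraction [T.LocallyFinite] (hq : 2 ≤ q) (hT : T.IsTree)
    (hreg : T.IsRegularOfDegree (q + 1)) (u : Fin (q + 2)) {μ : Measure (Config V)}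
    (hμ : IsFundamentalGroupOrbit (⊤ : SimpleGraph (Fin (q + 2))) u T o μ) (σ : Measure ℂ) :
    IsDiffractionMeasure T o q μ σ ↔ σ = atomicMeasure
      (fun j => completeComponents u j u / Fintype.card (Fin (q + 2))) (completeParams q) := by
  have hq2 : (2 : ℝ) ≤ q := by exact_mod_cast hq
  have ht := temperedParam_spec hq (a := -1) (by norm_num; linarith)
  refine isDiffractionMeasure_iff hq (isSpectralDecomposition_top u) SimpleGraph.connected_top
    (isRegularOfDegree_top q) (exists_iso_top u) hT hreg ?_ ?_ hμ σ
  · intro j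
    fin_cases j
    exacts [trivialParam_mem q, ht.1.1]
  · intro j
    fin_cases j
    exacts [adjEigenvalue_trivialParam hq, ht.2]

theorem complete_subOscNumberVariance [T.LocallyFinite] (hq : 2 ≤ q) (hT : T.IsTree)
    (hreg : T.IsRegularOfDegree (q + 1)) (u : Fin (q + 2)) (r : ℕ) :
    subOscNumberVariance T o q (atomicMeasure
      (fun j => completeComponents u j u / Fintype.card (Fin (q + 2))) (completeParams q)) r =
      completeComponents u 1 u / Fintype.card (Fin (q + 2)) * ballPoly q (-1) r ^ 2 := by
  have hq2 : (2 : ℝ) ≤ q := by exact_mod_cast hq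
  have ht := temperedParam_spec hq (a := -1) (by norm_num; linarith)
  rw [subOscNumberVariance_atomicMeasure hq hT hreg (a := completeEigenvalues q)
    (fun j => div_nonneg ((isSpectralDecomposition_top u).nonneg j) (by positivity))]
  · simp only [Fin.sum_univ_two, completeParams, Matrix.cons_val, completeEigenvalues]
    rw [Set.indicator_of_notMem trivialParam_notMem, Set.indicator_of_mem ht.1]
    ring
  · intro j
    fin_cases j
    exacts [adjEigenvalue_trivialParam hq, ht.2]

theorem complete_numberVariance [T.LocallyFinite] (hT : T.IsTree)
    (hreg : T.IsRegularOfDegree (q + 1)) (u : Fin (q + 2)) {μ : Measure (Config V)}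
    (hμ : IsFundamentalGroupOrbit (⊤ : SimpleGraph (Fin (q + 2))) u T o μ) (r : ℕ) :
    numberVariance T o μ r =
      completeComponents u 1 u / Fintype.card (Fin (q + 2)) * ballPoly q (-1) r ^ 2 := by
  rw [numberVariance_eq (isSpectralDecomposition_top u) (j₀ := 0)
    (fun w => by simp [completeComponents]) SimpleGraph.connected_top
    (isRegularOfDegree_top q) (exists_iso_top u) hT hreg hμ,
    show (Finset.univ.erase 0 : Finset (Fin 2)) = {1} from rfl, Finset.sum_singleton]
  rfl

/-- Both number variances of the complete graph are multiples of the squared ball polynomial at the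
eigenvalue `-1`. -/
theorem liminfPerVolume_ballPoly_neg_one [T.LocallyFinite] (hq : 2 ≤ q) (hT : T.IsTree)
    (hreg : T.IsRegularOfDegree (q + 1)) {b : ℝ} (hb : 0 ≤ b) :
    liminfPerVolume T o (fun r => b * ballPoly q (-1) r ^ 2) = 0 := by
  refine liminfPerVolume_eq_zero hT hreg hq (fun r => by positivity) fun ε hε => ?_
  have hb1 : 0 < b + 1 := by linarith
  refine (frequently_ballPoly_sq_le hq (a := -1) (by norm_num) one_ne_zero 0
    (div_pos hε hb1)).mono fun k hk => ?_
  rw [one_mul, add_zero] at hk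
  calc b * ballPoly q (-1) k ^ 2 ≤ (b + 1) * (ε / (b + 1) * q ^ k) := by
        gcongr
        linarith
    _ = ε * q ^ k := by field_simp

theorem bipartite_diffraction [T.LocallyFinite] (hq : 2 ≤ q) (hT : T.IsTree)
    (hreg : T.IsRegularOfDegree (q + 1)) (u : Fin (q + 1) ⊕ Fin (q + 1)) {μ : Measure (Config V)}
    (hμ : IsFundamentalGroupOrbit (completeBipartiteGraph (Fin (q + 1)) (Fin (q + 1))) u T o μ)
    (σ : Measure ℂ) :
    IsDiffractionMeasure T o q μ σ ↔ σ = atomicMeasure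
      (fun j => bipartiteComponents u j u / Fintype.card (Fin (q + 1) ⊕ Fin (q + 1)))
      (bipartiteParams q) := by
  have hq2 : (2 : ℝ) ≤ q := by exact_mod_cast hq
  have ht := temperedParam_spec hq (a := 0) (by norm_num; linarith)
  refine isDiffractionMeasure_iff hq (isSpectralDecomposition_bipartite u) (connected_bipartite q)
    (isRegularOfDegree_bipartite (q + 1)) (exists_iso_bipartite u) hT hreg ?_ ?_ hμ σ
  · intro j
    fin_cases j
    exacts [trivialParam_mem q, signParam_mem q, ht.1.1]
  · intro j
    fin_cases j
    exacts [adjEigenvalue_trivialParam hq, adjEigenvalue_signParam hq, ht.2]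

theorem bipartite_subOscNumberVariance [T.LocallyFinite] (hq : 2 ≤ q) (hT : T.IsTree)
    (hreg : T.IsRegularOfDegree (q + 1)) (u : Fin (q + 1) ⊕ Fin (q + 1)) (r : ℕ) :
    subOscNumberVariance T o q (atomicMeasure
      (fun j => bipartiteComponents u j u / Fintype.card (Fin (q + 1) ⊕ Fin (q + 1)))
      (bipartiteParams q)) r =
      bipartiteComponents u 2 u / Fintype.card (Fin (q + 1) ⊕ Fin (q + 1)) *
        ballPoly q 0 r ^ 2 := by
  have hq2 : (2 : ℝ) ≤ q := by exact_mod_cast hq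
  have ht := temperedParam_spec hq (a := 0) (by norm_num; linarith)
  rw [subOscNumberVariance_atomicMeasure hq hT hreg (a := bipartiteEigenvalues q)
    (fun j => div_nonneg ((isSpectralDecomposition_bipartite u).nonneg j) (by positivity))]
  · simp only [Fin.sum_univ_three, bipartiteParams, Matrix.cons_val, bipartiteEigenvalues]
    rw [Set.indicator_of_notMem trivialParam_notMem, Set.indicator_of_notMem signParam_notMem,
      Set.indicator_of_mem ht.1]
    ring
  · intro j
    fin_cases j
    exacts [adjEigenvalue_trivialParam hq, adjEigenvalue_signParam hq, ht.2]

theorem liminfPerVolume_bipartite [T.LocallyFinite] (hq : 2 ≤ q) (hT : T.IsTree)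
    (hreg : T.IsRegularOfDegree (q + 1)) (u : Fin (q + 1) ⊕ Fin (q + 1)) :
    0 < liminfPerVolume T o (subOscNumberVariance T o q (atomicMeasure
      (fun j => bipartiteComponents u j u / Fintype.card (Fin (q + 1) ⊕ Fin (q + 1)))
      (bipartiteParams q))) := by
  have hq2 : (2 : ℝ) ≤ q := by exact_mod_cast hq
  have hpos : 0 < bipartiteComponents u 2 u := by
    simp only [bipartiteComponents, Matrix.cons_val, if_true]
    rw [sub_pos, div_lt_one (by linarith)]
    linarith
  have hc : 0 < bipartiteComponents u 2 u / Fintype.card (Fin (q + 1) ⊕ Fin (q + 1)) :=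
    div_pos hpos (by exact_mod_cast Fintype.card_pos)
  refine liminfPerVolume_pos hT hreg hq (div_pos hc (by linarith : (0 : ℝ) < q)) fun r => ?_
  rw [bipartite_subOscNumberVariance hq hT hreg, div_mul_eq_mul_div, mul_div_assoc]
  refine mul_le_mul_of_nonneg_left ?_ hc.le
  rw [div_le_iff₀' (by linarith)]
  exact pow_le_ballPoly_zero_sq hq r

theorem petersen_diffraction [T.LocallyFinite] (hT : T.IsTree)
    (hreg : T.IsRegularOfDegree (2 + 1)) (u : ZMod 5 ⊕ ZMod 5) {μ : Measure (Config V)}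
    (hμ : IsFundamentalGroupOrbit petersenGraph u T o μ) (σ : Measure ℂ) :
    IsDiffractionMeasure T o 2 μ σ ↔ σ = atomicMeasure
      (fun j => petersenComponents u j u / Fintype.card (ZMod 5 ⊕ ZMod 5)) petersenParams := by
  have h1 := temperedParam_spec le_rfl (a := 1) (by norm_num)
  have h2 := temperedParam_spec le_rfl (a := -2) (by norm_num)
  refine isDiffractionMeasure_iff le_rfl (isSpectralDecomposition_petersen u) connected_petersen
    isRegularOfDegree_petersen (exists_iso_petersen u) hT hreg ?_ ?_ hμ σ
  · intro j
    fin_cases j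
    exacts [trivialParam_mem 2, h1.1.1, h2.1.1]
  · intro j
    fin_cases j
    exacts [(adjEigenvalue_trivialParam le_rfl).trans (by norm_num [petersenEigenvalues]),
      h1.2, h2.2]

theorem petersen_subOscNumberVariance [T.LocallyFinite] (hT : T.IsTree)
    (hreg : T.IsRegularOfDegree (2 + 1)) (u : ZMod 5 ⊕ ZMod 5) (r : ℕ) :
    subOscNumberVariance T o 2 (atomicMeasure
      (fun j => petersenComponents u j u / Fintype.card (ZMod 5 ⊕ ZMod 5)) petersenParams) r =
      petersenComponents u 1 u / Fintype.card (ZMod 5 ⊕ ZMod 5) * ballPoly 2 1 r ^ 2 +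
      petersenComponents u 2 u / Fintype.card (ZMod 5 ⊕ ZMod 5) * ballPoly 2 (-2) r ^ 2 := by
  have h1 := temperedParam_spec le_rfl (a := 1) (by norm_num)
  have h2 := temperedParam_spec le_rfl (a := -2) (by norm_num)
  rw [subOscNumberVariance_atomicMeasure le_rfl hT hreg (a := petersenEigenvalues)
    (fun j => div_nonneg ((isSpectralDecomposition_petersen u).nonneg j) (by positivity))]
  · simp only [Fin.sum_univ_three, petersenParams, Matrix.cons_val, petersenEigenvalues]
    rw [Set.indicator_of_notMem trivialParam_notMem, Set.indicator_of_mem h1.1,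
      Set.indicator_of_mem h2.1]
    ring
  · intro j
    fin_cases j
    exacts [(adjEigenvalue_trivialParam le_rfl).trans (by norm_num [petersenEigenvalues]),
      h1.2, h2.2]

/-- Along the radii `4k + 2`, where the contribution of the eigenvalue `-2` vanishes, the
contribution of the eigenvalue `1` is frequently small. -/
theorem liminfPerVolume_petersen [T.LocallyFinite] (hT : T.IsTree)
    (hreg : T.IsRegularOfDegree (2 + 1)) (u : ZMod 5 ⊕ ZMod 5) :
    liminfPerVolume T o (subOscNumberVariance T o 2 (atomicMeasure
      (fun j => petersenComponents u j u / Fintype.card (ZMod 5 ⊕ ZMod 5)) petersenParams)) =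
      0 := by
  have hc : ∀ j, 0 ≤ petersenComponents u j u / Fintype.card (ZMod 5 ⊕ ZMod 5) := fun j =>
    div_nonneg ((isSpectralDecomposition_petersen u).nonneg j) (by positivity)
  refine liminfPerVolume_eq_zero hT hreg le_rfl (fun r => ?_) fun ε hε => ?_
  · rw [petersen_subOscNumberVariance hT hreg]
    exact add_nonneg (mul_nonneg (hc 1) (sq_nonneg _)) (mul_nonneg (hc 2) (sq_nonneg _))
  set b := petersenComponents u 1 u / Fintype.card (ZMod 5 ⊕ ZMod 5) with hb
  have hb0 : 0 ≤ b := hc 1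
  have hb1 : 0 < b + 1 := by linarith
  have hlim : Tendsto (fun k : ℕ => 4 * k + 2) atTop atTop :=
    tendsto_atTop_mono (fun k => show k ≤ 4 * k + 2 by omega) tendsto_id
  refine hlim.frequently ((frequently_ballPoly_sq_le le_rfl (a := 1) (by norm_num)
    (by norm_num : 4 ≠ 0) 2 (div_pos hε hb1)).mono fun k hk => ?_)
  rw [petersen_subOscNumberVariance hT hreg, ballPoly_two_neg_two, zero_pow two_ne_zero, mul_zero,
    add_zero, ← hb]
  calc b * ballPoly 2 1 (4 * k + 2) ^ 2
      ≤ (b + 1) * (ε / (b + 1) * ((2 : ℕ) : ℝ) ^ (4 * k + 2)) := by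
        gcongr
        linarith
    _ = ε * ((2 : ℕ) : ℝ) ^ (4 * k + 2) := by field_simp

end NumberVariances

end TreeOrbit

open TreeOrbit in
theorem theorem1p4 (q : ℕ) (hq : 2 ≤ q) {V : Type*} (T : SimpleGraph V) (hT : T.IsTree)
    (hreg : ∀ x, (T.neighborSet x).ncard = q + 1) (o : V) :
    -- the complete graph on `q + 2` vertices
    (∀ (u : Fin (q + 2)) (μ : Measure (Config V)),
      IsFundamentalGroupOrbit (⊤ : SimpleGraph (Fin (q + 2))) u T o μ →
        (∃! σ, IsDiffractionMeasure T o q μ σ) ∧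
        ∀ σ, IsDiffractionMeasure T o q μ σ →
          liminfPerVolume T o (subOscNumberVariance T o q σ) = 0) ∧
    -- for the tetrahedron (`q = 2`), the same for the ordinary number variance
    (q = 2 → ∀ (u : Fin 4) (μ : Measure (Config V)),
      IsFundamentalGroupOrbit (⊤ : SimpleGraph (Fin 4)) u T o μ →
        liminfPerVolume T o (numberVariance T o μ) = 0) ∧
    -- the complete bipartite graph on `(q + 1) + (q + 1)` vertices
    (∀ (u : Fin (q + 1) ⊕ Fin (q + 1)) (μ : Measure (Config V)),
      IsFundamentalGroupOrbit (completeBipartiteGraph (Fin (q + 1)) (Fin (q + 1))) u T o μ →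
        (∃! σ, IsDiffractionMeasure T o q μ σ) ∧
        ∀ σ, IsDiffractionMeasure T o q μ σ →
          0 < liminfPerVolume T o (subOscNumberVariance T o q σ)) ∧
    -- the Petersen graph
    (q = 2 → ∀ (u : ZMod 5 ⊕ ZMod 5) (μ : Measure (Config V)),
      IsFundamentalGroupOrbit petersenGraph u T o μ →
        (∃! σ, IsDiffractionMeasure T o q μ σ) ∧
        ∀ σ, IsDiffractionMeasure T o q μ σ →
          liminfPerVolume T o (subOscNumberVariance T o q σ) = 0) := by
  classical
  have hfin : ∀ x, (T.neighborSet x).Finite := fun x =>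
    Set.finite_of_ncard_ne_zero (by rw [hreg]; omega)
  let _ : T.LocallyFinite := fun x => (hfin x).fintype
  have hreg' : T.IsRegularOfDegree (q + 1) := degree_eq_of_ncard hreg
  refine ⟨fun u μ hμ => ?_, ?_, fun u μ hμ => ?_, ?_⟩
  · have h := complete_diffraction hq hT hreg' u hμ
    refine ⟨⟨_, (h _).2 rfl, fun σ hσ => (h σ).1 hσ⟩, fun σ hσ => ?_⟩
    rw [(h σ).1 hσ, funext (complete_subOscNumberVariance hq hT hreg' u)]
    exact liminfPerVolume_ballPoly_neg_one hq hT hreg'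
      (div_nonneg ((isSpectralDecomposition_top u).nonneg 1) (by positivity))
  · rintro rfl u μ hμ
    rw [funext (complete_numberVariance (q := 2) hT hreg' u hμ)]
    exact liminfPerVolume_ballPoly_neg_one hq hT hreg'
      (div_nonneg ((isSpectralDecomposition_top (q := 2) u).nonneg 1) (by positivity))
  · have h := bipartite_diffraction hq hT hreg' u hμ
    refine ⟨⟨_, (h _).2 rfl, fun σ hσ => (h σ).1 hσ⟩, fun σ hσ => ?_⟩
    rw [(h σ).1 hσ]
    exact liminfPerVolume_bipartite hq hT hreg' u
  · rintro rfl u μ hμ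
    have h := petersen_diffraction hT hreg' u hμ
    refine ⟨⟨_, (h _).2 rfl, fun σ hσ => (h σ).1 hσ⟩, fun σ hσ => ?_⟩
    rw [(h σ).1 hσ]
    exact liminfPerVolume_petersen hT hreg' u
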